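/- Let $n\ge 1$, let $\Omega=\prod_{i=1}^n(a_i,b_i)\subset\mathbb{R}^n$ with $a_i<b_i$, let $\alpha\in(0,1)$, and let $p_i,q_i>0$ $(1\le i\le n)$ be constants with $\sum_{i=1}^n(p_i+q_i)=1$. For $\beta>0$ let $$J^{\beta}_{i}v(x)=\frac1{\Gamma(\beta)}\int_{a_i}^{x_i}(x_i-w)^{\beta-1}v(x_1,\dots,w,\dots,x_n)\,dw,\qquad J^{\beta}_{i-}v(x)=\frac1{\Gamma(\beta)}\int_{x_i}^{b_i}(w-x_i)^{\beta-1}v(x_1,\dots,w,\dots,x_n)\,dw$$ be the left and right Riemann–Liouville fractional integrals in the variable $x_i$ ($w$ stands in the $i$-th place), and let $J^0_i$ be the identity. For $0<s\le 1$ put $\partial^s_{x_i}v=\partial_{x_i}(J^{1-s}_iv)$, where $\partial_{x_i}$ is the weak derivative on $\Omega$, and $$\hat H_s(\Omega)=\{v\in L^2(\Omega):\ \partial^s_{x_i}v\in L^2(\Omega)\ \text{for } i=1,\dots,n\},\qquad \|v\|_{\hat H_s(\Omega)}^2=\sum_{i=1}^n\|\partial^s_{x_i}v\|_{L^2(\Omega)}^2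 .$$ Let $f\in L^1_{\mathrm{loc}}(\Omega)$ and $g\in L^2(\partial\Omega)$ be real valued, and consider the Dirichlet problem $$\mathcal{L}u:=-\sum_{i=1}^n\partial_{x_i}\bigl(p_iJ^\alpha_i+q_iJ^\alpha_{i-}\bigr)\partial_{x_i}u=f\ \text{ in }\Omega,\qquad u=g\ \text{ on }\partial\Omega .$$ A solution in $\hat H_1(\Omega)$ is a real-valued function $u\in\hat H_1(\Omega)$ that satisfies the equation in the sense of distributions, i.e. $$\sum_{i=1}^n\int_\Omega \bigl(p_iJ^\alpha_i\partial_{x_i}u+q_iJ^\alpha_{i-}\partial_{x_i}u\bigr)\,\partial_{x_i}\varphi\,dx=\int_\Omega f\varphi\,dx\qquad\text{for all }\varphi\in C_c^\infty(\Omega),$$ and the boundary condition in the sense of traces. **Theorem (conditional uniqueness).** If $u_1,u_2\in\hat H_1(\Omega)$ are two solutions of this Dirichlet problem, then $u_1-u_2\in\hat H_{1-\alpha}(\Omega)$ and $$\|u_1-u_2\|_{\hat H_{1-\alpha}(\Omega)}=0 .$$ -/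

import Mathlib

open MeasureTheory Filter Topology
open scoped ContDiff

noncomputable section

namespace FADE

variable {n : ℕ}

/-- The open box `Ω = ∏ᵢ (aᵢ, bᵢ)` in `ℝⁿ`. -/
def box (a b : Fin n → ℝ) : Set (Fin n → ℝ) :=
  Set.pi Set.univ fun i => Set.Ioo (a i) (b i)

/-- Lebesgue measure on the box. -/
def boxMeasure (a b : Fin n → ℝ) : Measure (Fin n → ℝ) :=
  volume.restrict (box a b)

/-- The classical partial derivative `∂φ/∂xᵢ`. -/
def partialD (i : Fin n) (φ : (Fin n → ℝ) → ℝ) (x : Fin n → ℝ) : ℝ :=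
  fderiv ℝ φ x (Pi.single i 1)

/-- Test functions: the elements of `C_c^∞(Ω)`. -/
structure IsTestFunction (Ω : Set (Fin n → ℝ)) (φ : (Fin n → ℝ) → ℝ) : Prop where
  smooth : ContDiff ℝ ∞ φ
  compactSupport : HasCompactSupport φ
  support_subset : tsupport φ ⊆ Ω

/-- `D` is the weak (distributional) partial derivative `∂v/∂xᵢ` of `v` on the open set `Ω`. -/
structure IsWeakPartial (Ω : Set (Fin n → ℝ)) (i : Fin n) (v D : (Fin n → ℝ) → ℝ) : Prop where
  locallyIntegrable : LocallyIntegrableOn v Ω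
  locallyIntegrable_deriv : LocallyIntegrableOn D Ω
  integral_eq : ∀ φ, IsTestFunction Ω φ →
    ∫ x in Ω, v x * partialD i φ x = -∫ x in Ω, D x * φ x

open Classical in
/-- The weak partial derivative `∂v/∂xᵢ` on `Ω`. It is unique up to equality almost everywhere
on `Ω`; a representative is chosen. The value is `0` if there is no weak derivative, and it is
only used together with the existence of the weak derivative. -/
def weakPartial (Ω : Set (Fin n → ℝ)) (i : Fin n) (v : (Fin n → ℝ) → ℝ) : (Fin n → ℝ) → ℝ :=
  if h : ∃ D, IsWeakPartial Ω i v D then h.choose else 0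

open Classical in
/-- The left Riemann-Liouville fractional integral of order `β ≥ 0` in the variable `xᵢ`,
over `(aᵢ, xᵢ)`; the one of order `0` is the identity. -/
def leftInt (a : Fin n → ℝ) (β : ℝ) (i : Fin n) (v : (Fin n → ℝ) → ℝ) (x : Fin n → ℝ) : ℝ :=
  if β = 0 then v x
  else (1 / Real.Gamma β) *
    ∫ w in (a i)..(x i), (x i - w) ^ (β - 1) * v (Function.update x i w)

open Classical in
/-- The right Riemann-Liouville fractional integral of order `β ≥ 0` in the variable `xᵢ`,
over `(xᵢ, bᵢ)`; the one of order `0` is the identity. -/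
def rightInt (b : Fin n → ℝ) (β : ℝ) (i : Fin n) (v : (Fin n → ℝ) → ℝ) (x : Fin n → ℝ) : ℝ :=
  if β = 0 then v x
  else (1 / Real.Gamma β) *
    ∫ w in (x i)..(b i), (w - x i) ^ (β - 1) * v (Function.update x i w)

/-- The (left) Riemann-Liouville derivative `∂ˢv/∂xᵢˢ = ∂/∂xᵢ (J^{1-s} v)`, `0 < s ≤ 1`, the
outer derivative being a weak one on the box. For `s = 1` it is the weak derivative `∂v/∂xᵢ`. -/
def rlDeriv (a b : Fin n → ℝ) (s : ℝ) (i : Fin n) (v : (Fin n → ℝ) → ℝ) : (Fin n → ℝ) → ℝ :=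
  weakPartial (box a b) i (leftInt a (1 - s) i v)

/-- Membership in `Ĥ_s(Ω) = {v ∈ L²(Ω) : ∂ˢv/∂xᵢˢ ∈ L²(Ω) for all i}`, `0 < s ≤ 1`. -/
structure MemHhat (a b : Fin n → ℝ) (s : ℝ) (v : (Fin n → ℝ) → ℝ) : Prop where
  memLp : MemLp v 2 (boxMeasure a b)
  exists_deriv : ∀ i, ∃ D, IsWeakPartial (box a b) i (leftInt a (1 - s) i v) D
  memLp_deriv : ∀ i, MemLp (rlDeriv a b s i v) 2 (boxMeasure a b)

/-- `‖v‖_{Ĥ_s(Ω)} = (∑ᵢ ‖∂ˢv/∂xᵢˢ‖²_{L²(Ω)})^{1/2}`, for `v ∈ Ĥ_s(Ω)`. -/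
def hhatNorm (a b : Fin n → ℝ) (s : ℝ) (v : (Fin n → ℝ) → ℝ) : ℝ :=
  Real.sqrt (∑ i, ∫ x in box a b, (rlDeriv a b s i v x) ^ 2)

/-- The surface measure on the part of the hyperplane `xᵢ = c` that projects onto the box:
the box is projected onto the hyperplane along the `i`-th axis and the image of Lebesgue measure
is divided by the length `bᵢ - aᵢ` of the fibres. -/
def faceMeasure (a b : Fin n → ℝ) (i : Fin n) (c : ℝ) : Measure (Fin n → ℝ) :=
  (ENNReal.ofReal (b i - a i))⁻¹ •
    (boxMeasure a b).map fun x => Function.update x i c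

/-- The surface measure on the boundary of the box: the sum over its `2n` faces. -/
def boundaryMeasure (a b : Fin n → ℝ) : Measure (Fin n → ℝ) :=
  ∑ i, (faceMeasure a b i (a i) + faceMeasure a b i (b i))

/-- `u = g` on `∂Ω` in the sense of traces, for `u` with weak first derivatives in `L²(Ω)`:
there are functions `φₖ`, smooth up to the boundary, with `φₖ → u` in `H¹(Ω)` and
`φₖ|∂Ω → g` in `L²(∂Ω)`. -/
def HasTrace (a b : Fin n → ℝ) (u g : (Fin n → ℝ) → ℝ) : Prop :=
  MemLp g 2 (boundaryMeasure a b) ∧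
  ∃ φ : ℕ → (Fin n → ℝ) → ℝ,
    (∀ k, ContDiff ℝ ∞ (φ k)) ∧
    Tendsto (fun k => eLpNorm (fun x => φ k x - u x) 2 (boxMeasure a b)) atTop (𝓝 0) ∧
    (∀ i, Tendsto (fun k => eLpNorm
      (fun x => partialD i (φ k) x - weakPartial (box a b) i u x) 2 (boxMeasure a b))
      atTop (𝓝 0)) ∧
    Tendsto (fun k => eLpNorm (fun x => φ k x - g x) 2 (boundaryMeasure a b)) atTop (𝓝 0)

/-- The `i`-th flux `(pᵢ J^α_{left} + qᵢ J^α_{right}) ∂u/∂xᵢ`. -/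
def flux (a b : Fin n → ℝ) (α : ℝ) (p q : Fin n → ℝ) (i : Fin n)
    (u : (Fin n → ℝ) → ℝ) (x : Fin n → ℝ) : ℝ :=
  p i * leftInt a α i (weakPartial (box a b) i u) x +
    q i * rightInt b α i (weakPartial (box a b) i u) x

/-- `u ∈ Ĥ₁(Ω)` solves the Dirichlet problem `-∑ᵢ ∂/∂xᵢ (flux)ᵢ = f` in `Ω` (in the sense of
distributions), `u = g` on `∂Ω` (in the sense of traces). -/
structure IsSolution (a b : Fin n → ℝ) (α : ℝ) (p q : Fin n → ℝ)
    (f g u : (Fin n → ℝ) → ℝ) : Prop where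
  memHhat : MemHhat a b 1 u
  equation : ∀ φ, IsTestFunction (box a b) φ →
    ∑ i, ∫ x in box a b, flux a b α p q i u x * partialD i φ x = ∫ x in box a b, f x * φ x
  boundary : HasTrace a b u g

end FADE

end

/-! Put `v = u₁ - u₂` and `Dᵢ = ∂ᵢu₁ - ∂ᵢu₂`. The proof gives more than a vanishing seminorm: `v =
0` almost everywhere. It is an energy argument, with `v` itself in the role of the test function.

Testing. The difference `F` of the two flux fields is square integrable and divergence free as a
distribution. Only compactly supported test functions are available, so `v` is replaced by its
smooth approximations times a cut-off `χ_δ`. The error `∫ Fᵢ (∂ᵢχ_δ) v` lives on strips of width of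
order `δ` along the faces. There `|∂ᵢχ_δ| ≤ C/δ`, while zero trace gives `‖v‖ ≤ C'δ‖Dᵢ‖`
(`IsZeroTraceApprox.slab_le`), so the powers of `δ` cancel and the `L²` norm of `Fᵢ` on a shrinking
strip sends the error to zero. Hence `∑ᵢ ∫ Fᵢ Dᵢ = 0`
(`IsZeroTraceApprox.sum_integral_mul_eq_zero`).

Coercivity. The left and right fractional integrals are adjoint, so they have the same quadratic
form, and the `i`-th term is `(pᵢ + qᵢ) ∫ (J^α Dᵢ) Dᵢ`. Symmetrised on each line parallel to the
`i`-th axis, this form has the Riesz kernel `|x - y| ^ (α - 1)`. That kernel is a positive mixture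
of rank one kernels `1_W(x) 1_W(y)` over intervals `W = (z, z + h)` with density `h ^ (α - 3)`. So
the energy of `f` is, up to a positive constant, the weighted integral of `(∫_W f)²`
(`tentConst_mul_energy`): it is nonnegative and vanishes only for `f = 0`. Therefore every `Dᵢ`
vanishes (`ae_eq_zero_of_sum_energy`).

Conclusion. The strip estimate on the whole box is a Poincaré inequality, so `v = 0` almost
everywhere, and with it all its fractional integrals and their weak derivatives. -/

namespace FADE

/-! ### Exchanging a coordinate of the box with an extra variable -/

section Swap

variable {n : ℕ}

/-- Lebesgue measure on the `i`-th side of the box. -/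
noncomputable def axisMeasure (a b : Fin n → ℝ) (i : Fin n) : Measure ℝ :=
  volume.restrict (Set.Ioo (a i) (b i))

instance (a b : Fin n → ℝ) (i : Fin n) : IsFiniteMeasure (axisMeasure a b i) := by
  unfold axisMeasure; infer_instance

theorem boxMeasure_eq_pi (a b : Fin n → ℝ) :
    boxMeasure a b = Measure.pi fun i => axisMeasure a b i := by
  rw [boxMeasure, box, volume_pi, Measure.restrict_pi_pi]; rfl

instance (a b : Fin n → ℝ) : IsFiniteMeasure (boxMeasure a b) := by
  rw [boxMeasure_eq_pi]; infer_instance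

theorem isOpen_box (a b : Fin n → ℝ) : IsOpen (box a b) :=
  isOpen_set_pi Set.finite_univ fun _ _ => isOpen_Ioo

theorem measurableSet_box (a b : Fin n → ℝ) : MeasurableSet (box a b) :=
  (isOpen_box a b).measurableSet

theorem ae_mem_box (a b : Fin n → ℝ) : ∀ᵐ x ∂boxMeasure a b, x ∈ box a b :=
  ae_restrict_mem (measurableSet_box a b)

theorem axisMeasure_univ (a b : Fin n → ℝ) (i : Fin n) :
    axisMeasure a b i Set.univ = ENNReal.ofReal (b i - a i) := by
  simp [axisMeasure]

theorem axisMeasure_ne_zero {a b : Fin n → ℝ} {i : Fin n} (hab : a i < b i) :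
    axisMeasure a b i ≠ 0 := by
  rw [← Measure.measure_univ_ne_zero, axisMeasure_univ]
  simpa using hab

/-- Exchange of the `i`-th coordinate with the extra variable. -/
def swapCoord (i : Fin n) (z : (Fin n → ℝ) × ℝ) : (Fin n → ℝ) × ℝ :=
  (Function.update z.1 i z.2, z.1 i)

theorem measurable_swapCoord (i : Fin n) : Measurable (swapCoord i) := by
  refine Measurable.prodMk ?_ ((measurable_pi_apply i).comp measurable_fst)
  exact measurable_update'.comp measurable_id

theorem measurable_updateCoord (i : Fin n) :
    Measurable fun z : (Fin n → ℝ) × ℝ => Function.update z.1 i z.2 :=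
  measurable_fst.comp (measurable_swapCoord i)

@[simp] theorem swapCoord_swapCoord (i : Fin n) (z : (Fin n → ℝ) × ℝ) :
    swapCoord i (swapCoord i z) = z := by
  simp [swapCoord]

theorem swapCoord_preimage (i : Fin n) (s : Fin n → Set ℝ) (t : Set ℝ) :
    swapCoord i ⁻¹' (Set.univ.pi s ×ˢ t) = Set.univ.pi (Function.update s i t) ×ˢ s i := by
  ext ⟨x, w⟩
  simp only [swapCoord, Set.mem_preimage, Set.mem_prod, Set.mem_univ_pi]
  constructor
  · rintro ⟨h, h'⟩
    refine ⟨fun j => ?_, by simpa using h i⟩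
    by_cases hj : j = i
    · subst hj; simpa using h'
    · simpa [hj] using h j
  · rintro ⟨h, h'⟩
    refine ⟨fun j => ?_, by simpa using h i⟩
    by_cases hj : j = i
    · subst hj; simpa using h'
    · simpa [hj] using h j

/-- On a rectangle the swap only exchanges two factors that carry the same measure, and rectangles
generate the product. This is the substitute for splitting `ℝⁿ` into the `i`-th axis and its
complement: lines through the box become slices of `Ω × (aᵢ, bᵢ)`. -/
theorem measurePreserving_swapCoord (a b : Fin n → ℝ) (i : Fin n) :
    MeasurePreserving (swapCoord i) ((boxMeasure a b).prod (axisMeasure a b i))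
      ((boxMeasure a b).prod (axisMeasure a b i)) := by
  refine ⟨measurable_swapCoord i, Eq.symm ?_⟩
  rw [boxMeasure_eq_pi]
  refine Measure.prod_eq_generateFrom generateFrom_pi
    MeasurableSpace.generateFrom_measurableSet isPiSystem_pi
    MeasurableSpace.isPiSystem_measurableSet
    (Measure.FiniteSpanningSetsIn.pi fun i => (axisMeasure a b i).toFiniteSpanningSetsIn)
    (axisMeasure a b i).toFiniteSpanningSetsIn ?_
  rintro _ ⟨s, hs, rfl⟩ t ht
  have hs' : ∀ j, MeasurableSet (s j) := fun j => hs j (Set.mem_univ j)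
  rw [Measure.map_apply (measurable_swapCoord i)
    ((MeasurableSet.univ_pi hs').prod ht), swapCoord_preimage, Measure.prod_prod,
    Measure.pi_pi, Measure.pi_pi, Fintype.prod_eq_mul_prod_compl i,
    Fintype.prod_eq_mul_prod_compl i (fun j => axisMeasure a b j (s j)), Function.update_self]
  have : ∏ j ∈ {i}ᶜ, axisMeasure a b j (Function.update s i t j)
      = ∏ j ∈ {i}ᶜ, axisMeasure a b j (s j) := by
    refine Finset.prod_congr rfl fun j hj => ?_
    rw [Function.update_of_ne (by simpa using hj)]
  rw [this]; ring

theorem quasiMeasurePreserving_updateCoord (a b : Fin n → ℝ) (i : Fin n) :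
    Measure.QuasiMeasurePreserving (fun z : (Fin n → ℝ) × ℝ => Function.update z.1 i z.2)
      ((boxMeasure a b).prod (axisMeasure a b i)) (boxMeasure a b) :=
  Measure.quasiMeasurePreserving_fst.comp
    (measurePreserving_swapCoord a b i).quasiMeasurePreserving

theorem ae_ae_update {a b : Fin n → ℝ} (i : Fin n) {P : (Fin n → ℝ) → Prop}
    (h : ∀ᵐ x ∂boxMeasure a b, P x) :
    ∀ᵐ x ∂boxMeasure a b, ∀ᵐ w ∂axisMeasure a b i, P (Function.update x i w) :=
  Measure.ae_ae_of_ae_prod ((quasiMeasurePreserving_updateCoord a b i).ae h)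

/-- After the swap, the property at `z` concerns `z.1` alone; since the side has positive measure,
almost every `x` has at least one witness `w`, and that is enough. -/
theorem ae_of_ae_ae_update {a b : Fin n → ℝ} {i : Fin n} (hab : a i < b i)
    {P : (Fin n → ℝ) → Prop} (hP : MeasurableSet {x | P x})
    (h : ∀ᵐ x ∂boxMeasure a b, ∀ᵐ w ∂axisMeasure a b i, P (Function.update x i w)) :
    ∀ᵐ x ∂boxMeasure a b, P x := by
  have h1 : ∀ᵐ z ∂(boxMeasure a b).prod (axisMeasure a b i),
      P (Function.update z.1 i z.2) :=
    (Measure.ae_prod_iff_ae_ae (measurable_updateCoord i hP)).2 h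
  have h2 : ∀ᵐ z ∂(boxMeasure a b).prod (axisMeasure a b i), P z.1 := by
    filter_upwards [(measurePreserving_swapCoord a b i).quasiMeasurePreserving.ae h1] with z hz
    simpa [swapCoord] using hz
  have h3 := Measure.ae_ae_of_ae_prod h2
  filter_upwards [h3] with x hx
  have : (ae (axisMeasure a b i)).NeBot := ae_neBot.2 (axisMeasure_ne_zero hab)
  exact hx.exists.choose_spec

/-- After the swap the integrand no longer depends on the extra variable, which contributes the
length of the side. -/
theorem lintegral_prod_update (a b : Fin n → ℝ) (i : Fin n) {f : (Fin n → ℝ) → ENNReal}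
    (hf : Measurable f) :
    ∫⁻ x, ∫⁻ w, f (Function.update x i w) ∂axisMeasure a b i ∂boxMeasure a b
      = ENNReal.ofReal (b i - a i) * ∫⁻ x, f x ∂boxMeasure a b := by
  rw [← lintegral_prod (fun z : (Fin n → ℝ) × ℝ => f (Function.update z.1 i z.2))
    (hf.comp (measurable_updateCoord i)).aemeasurable]
  have := (measurePreserving_swapCoord a b i).lintegral_comp (hf.comp measurable_fst)
  rw [show (fun z : (Fin n → ℝ) × ℝ => f (Function.update z.1 i z.2))
    = fun z => (f ∘ Prod.fst) (swapCoord i z) from rfl, this,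
    lintegral_prod _ (hf.comp measurable_fst).aemeasurable]
  simp [axisMeasure_univ, lintegral_mul_const _ hf, mul_comm]

end Swap

/-! ### Integral operators with a Schur kernel -/

section Schur

variable {X Y : Type*} [MeasurableSpace X] [MeasurableSpace Y] {μ : Measure X} {ν : Measure Y}
  {κ : X × Y → ℝ} {C : ENNReal} {g : X → ℝ}

/-- Weighted Cauchy–Schwarz: the quadratic polynomial `t ↦ ∫ k (t - f)²` is nonnegative, so its
discriminant is not positive. -/
theorem sq_integral_mul_le {k f : Y → ℝ} (hk0 : ∀ y, 0 ≤ k y) (hk : Integrable k ν)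
    (hkf : Integrable (fun y => k y * f y) ν) (hkf2 : Integrable (fun y => k y * f y ^ 2) ν) :
    (∫ y, k y * f y ∂ν) ^ 2 ≤ (∫ y, k y ∂ν) * ∫ y, k y * f y ^ 2 ∂ν := by
  have key : ∀ t : ℝ, 0 ≤ (∫ y, k y ∂ν) * (t * t) + (-2 * ∫ y, k y * f y ∂ν) * t
      + ∫ y, k y * f y ^ 2 ∂ν := by
    intro t
    have h0 : 0 ≤ ∫ y, k y * (t - f y) ^ 2 ∂ν :=
      integral_nonneg fun y => mul_nonneg (hk0 y) (sq_nonneg _)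
    have h1 : (fun y => k y * (t - f y) ^ 2)
        = fun y => (t * t) * k y + (-2 * t) * (k y * f y) + k y * f y ^ 2 := by
      ext y; ring
    have h2 : Integrable (fun y => (t * t) * k y + (-2 * t) * (k y * f y)) ν :=
      (hk.const_mul _).add (hkf.const_mul _)
    rw [h1, integral_add h2 hkf2, integral_add (hk.const_mul _) (hkf.const_mul _), integral_const_mul,
      integral_const_mul] at h0
    linarith
  have := discrim_le_zero key
  rw [discrim] at this
  nlinarith

theorem integrable_of_mul_sq {k f : Y → ℝ} (hk0 : ∀ y, 0 ≤ k y) (hk : Integrable k ν)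
    (hf : Measurable f) (hkf2 : Integrable (fun y => k y * f y ^ 2) ν) :
    Integrable (fun y => k y * f y) ν := by
  refine (hk.add hkf2).mono' (hk.aestronglyMeasurable.mul hf.aestronglyMeasurable)
    (Eventually.of_forall fun y => ?_)
  rw [Real.norm_eq_abs, abs_mul, abs_of_nonneg (hk0 y), Pi.add_apply]
  nlinarith [hk0 y, mul_nonneg (hk0 y) (sq_nonneg (|f y| - 1)), sq_abs (f y),
    mul_nonneg (hk0 y) (sq_nonneg (f y))]

theorem integrable_kernel_slice (hκ : Measurable κ) (hκ0 : ∀ z, 0 ≤ κ z) (hC : C ≠ ⊤)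
    {x : X} (hx : ∫⁻ y, ENNReal.ofReal (κ (x, y)) ∂ν ≤ C) :
    Integrable (fun y => κ (x, y)) ν := by
  refine ⟨(hκ.comp measurable_prodMk_left).aestronglyMeasurable, ?_⟩
  rw [hasFiniteIntegral_iff_ofReal (Eventually.of_forall fun y => hκ0 _)]
  exact hx.trans_lt hC.lt_top

variable [SFinite ν]

theorem integrable_kernel_mul_sq (hκ : Measurable κ) (hκ0 : ∀ z, 0 ≤ κ z)
    (hC : C ≠ ⊤) (hκC : ∀ᵐ x ∂μ, ∫⁻ y, ENNReal.ofReal (κ (x, y)) ∂ν ≤ C)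
    (hg : Measurable g) (hg2 : MemLp g 2 μ) :
    Integrable (fun z => κ z * g z.1 ^ 2) (μ.prod ν) := by
  have hm : Measurable fun z : X × Y => κ z * g z.1 ^ 2 :=
    hκ.mul ((hg.comp measurable_fst).pow_const 2)
  refine ⟨hm.aestronglyMeasurable, ?_⟩
  rw [hasFiniteIntegral_iff_ofReal
    (Eventually.of_forall fun z => mul_nonneg (hκ0 z) (sq_nonneg _)),
    lintegral_prod _ hm.ennreal_ofReal.aemeasurable]
  have hsq : Integrable (fun x => g x ^ 2) μ := hg2.integrable_sq
  calc ∫⁻ x, ∫⁻ y, ENNReal.ofReal (κ (x, y) * g x ^ 2) ∂ν ∂μ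
      ≤ ∫⁻ x, C * ENNReal.ofReal (g x ^ 2) ∂μ := by
        refine lintegral_mono_ae ?_
        filter_upwards [hκC] with x hx
        simp_rw [ENNReal.ofReal_mul (hκ0 _)]
        rw [lintegral_mul_const _ (show Measurable fun y => ENNReal.ofReal (κ (x, y)) from
          (hκ.comp measurable_prodMk_left).ennreal_ofReal)]
        gcongr
    _ = C * ∫⁻ x, ENNReal.ofReal (g x ^ 2) ∂μ :=
        lintegral_const_mul _ (hg.pow_const 2).ennreal_ofReal
    _ < ⊤ := ENNReal.mul_lt_top hC.lt_top
        ((hasFiniteIntegral_iff_ofReal (Eventually.of_forall fun x => sq_nonneg _)).1 hsq.2)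

variable {T : X × Y → X × Y}

/-- The involution `T` transposes the kernel, so `hκT` is the column bound of the Schur test. It is
`Prod.swap` on an interval and `swapCoord i` on the box, where the two factors of the product are
different spaces. -/
theorem integrable_kernel_mul_sq_comp (hT : MeasurePreserving T (μ.prod ν) (μ.prod ν))
    (hTT : ∀ z, T (T z) = z) (hκ : Measurable κ) (hκ0 : ∀ z, 0 ≤ κ z) (hC : C ≠ ⊤)
    (hκT : ∀ᵐ x ∂μ, ∫⁻ y, ENNReal.ofReal (κ (T (x, y))) ∂ν ≤ C)
    (hg : Measurable g) (hg2 : MemLp g 2 μ) :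
    Integrable (fun z => κ z * g (T z).1 ^ 2) (μ.prod ν) := by
  have h := (integrable_kernel_mul_sq (κ := κ ∘ T) (hκ.comp hT.measurable) (fun z => hκ0 _)
    hC hκT hg hg2)
  have := hT.integrable_comp_of_integrable h
  simpa [Function.comp_def, hTT] using this

theorem integrable_kernel_mul_mul (hT : MeasurePreserving T (μ.prod ν) (μ.prod ν))
    (hTT : ∀ z, T (T z) = z) (hκ : Measurable κ) (hκ0 : ∀ z, 0 ≤ κ z) (hC : C ≠ ⊤)
    (hκC : ∀ᵐ x ∂μ, ∫⁻ y, ENNReal.ofReal (κ (x, y)) ∂ν ≤ C)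
    (hκT : ∀ᵐ x ∂μ, ∫⁻ y, ENNReal.ofReal (κ (T (x, y))) ∂ν ≤ C)
    (hg : Measurable g) (hg2 : MemLp g 2 μ) :
    Integrable (fun z => κ z * (g z.1 * g (T z).1)) (μ.prod ν) := by
  refine ((integrable_kernel_mul_sq hκ hκ0 hC hκC hg hg2).add
    (integrable_kernel_mul_sq_comp hT hTT hκ hκ0 hC hκT hg hg2)).mono'
    (hκ.mul ((hg.comp measurable_fst).mul
      (hg.comp (measurable_fst.comp hT.measurable)))).aestronglyMeasurable
    (Eventually.of_forall fun z => ?_)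
  rw [Real.norm_eq_abs, abs_mul, abs_of_nonneg (hκ0 z), Pi.add_apply, ← mul_add]
  refine mul_le_mul_of_nonneg_left ?_ (hκ0 z)
  rw [abs_le]
  constructor <;> nlinarith [sq_nonneg (g z.1 + g (T z).1), sq_nonneg (g z.1 - g (T z).1),
    sq_nonneg (g z.1), sq_nonneg (g (T z).1)]

variable [SFinite μ]

theorem ae_integrable_kernel_mul (hT : MeasurePreserving T (μ.prod ν) (μ.prod ν))
    (hTT : ∀ z, T (T z) = z) (hκ : Measurable κ) (hκ0 : ∀ z, 0 ≤ κ z) (hC : C ≠ ⊤)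
    (hκC : ∀ᵐ x ∂μ, ∫⁻ y, ENNReal.ofReal (κ (x, y)) ∂ν ≤ C)
    (hκT : ∀ᵐ x ∂μ, ∫⁻ y, ENNReal.ofReal (κ (T (x, y))) ∂ν ≤ C)
    (hg : Measurable g) (hg2 : MemLp g 2 μ) :
    ∀ᵐ x ∂μ, Integrable (fun y => κ (x, y) * g (T (x, y)).1) ν := by
  have h := (integrable_kernel_mul_sq_comp hT hTT hκ hκ0 hC hκT hg hg2).prod_right_ae
  filter_upwards [h, hκC] with x hx hxC
  exact integrable_of_mul_sq (fun y => hκ0 _) (integrable_kernel_slice hκ hκ0 hC hxC)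
    ((hg.comp (measurable_fst.comp hT.measurable)).comp measurable_prodMk_left) hx

/-- The Schur test: Cauchy–Schwarz with weight `κ (x, ·)` uses the row bound pointwise, and the
column bound controls the remaining double integral. -/
theorem memLp_two_integral_kernel_mul (hT : MeasurePreserving T (μ.prod ν) (μ.prod ν))
    (hTT : ∀ z, T (T z) = z) (hκ : Measurable κ) (hκ0 : ∀ z, 0 ≤ κ z) (hC : C ≠ ⊤)
    (hκC : ∀ᵐ x ∂μ, ∫⁻ y, ENNReal.ofReal (κ (x, y)) ∂ν ≤ C)
    (hκT : ∀ᵐ x ∂μ, ∫⁻ y, ENNReal.ofReal (κ (T (x, y))) ∂ν ≤ C)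
    (hg : Measurable g) (hg2 : MemLp g 2 μ) :
    MemLp (fun x => ∫ y, κ (x, y) * g (T (x, y)).1 ∂ν) 2 μ := by
  have hm : Measurable fun z : X × Y => κ z * g (T z).1 :=
    hκ.mul (hg.comp (measurable_fst.comp hT.measurable))
  have hs : AEStronglyMeasurable (fun x => ∫ y, κ (x, y) * g (T (x, y)).1 ∂ν) μ :=
    (hm.stronglyMeasurable.integral_prod_right).aestronglyMeasurable
  have hI := integrable_kernel_mul_sq_comp hT hTT hκ hκ0 hC hκT hg hg2
  rw [memLp_two_iff_integrable_sq hs]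
  refine (hI.integral_prod_left.const_mul C.toReal).mono' (hs.pow 2) ?_
  filter_upwards [hI.prod_right_ae, hκC,
    ae_integrable_kernel_mul hT hTT hκ hκ0 hC hκC hκT hg hg2] with x hx hxC hx1
  have hk := integrable_kernel_slice hκ hκ0 hC hxC
  rw [Real.norm_eq_abs, abs_of_nonneg (sq_nonneg _)]
  refine (sq_integral_mul_le (fun y => hκ0 _) hk hx1 hx).trans ?_
  refine mul_le_mul_of_nonneg_right ?_
    (integral_nonneg fun y => mul_nonneg (hκ0 _) (sq_nonneg _))
  rw [integral_eq_lintegral_of_nonneg_ae (Eventually.of_forall fun y => hκ0 _)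
    hk.aestronglyMeasurable]
  exact ENNReal.toReal_mono hC hxC

end Schur

/-! ### The Riemann-Liouville kernel on the line -/

section Kernel

/-- The kernel `t ^ (α - 1)` on `t > 0`, extended by zero. -/
noncomputable def rlKernel (α t : ℝ) : ℝ := (Set.Ioi (0 : ℝ)).indicator (fun t => t ^ (α - 1)) t

theorem measurable_rlKernel (α : ℝ) : Measurable (rlKernel α) :=
  (measurable_id.pow_const _).indicator measurableSet_Ioi

theorem rlKernel_nonneg (α t : ℝ) : 0 ≤ rlKernel α t :=
  Set.indicator_nonneg (fun _ ht => Real.rpow_nonneg (le_of_lt ht) _) t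

theorem rlKernel_of_pos (α : ℝ) {t : ℝ} (ht : 0 < t) : rlKernel α t = t ^ (α - 1) :=
  Set.indicator_of_mem (Set.mem_Ioi.2 ht) _

theorem rlKernel_of_nonpos (α : ℝ) {t : ℝ} (ht : t ≤ 0) : rlKernel α t = 0 :=
  Set.indicator_of_notMem (by simpa using ht) _

theorem rlKernel_add_rlKernel {α x y : ℝ} (h : x ≠ y) :
    rlKernel α (x - y) + rlKernel α (y - x) = |x - y| ^ (α - 1) := by
  rcases lt_or_gt_of_ne h with h | h
  · rw [rlKernel_of_nonpos α (by linarith), rlKernel_of_pos α (by linarith), zero_add,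
      abs_of_neg (by linarith), neg_sub]
  · rw [rlKernel_of_pos α (by linarith), rlKernel_of_nonpos α (by linarith), add_zero,
      abs_of_pos (by linarith)]

/-- The mass of the kernel on `(0, l)`. -/
noncomputable def rlMass (α l : ℝ) : ENNReal :=
  ∫⁻ t in Set.Ioc 0 l, ENNReal.ofReal (t ^ (α - 1))

theorem rlMass_ne_top {α : ℝ} (hα : 0 < α) {l : ℝ} (hl : 0 ≤ l) : rlMass α l ≠ ⊤ := by
  have h : IntervalIntegrable (fun t : ℝ => t ^ (α - 1)) volume 0 l :=
    intervalIntegral.intervalIntegrable_rpow' (by linarith)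
  rw [intervalIntegrable_iff_integrableOn_Ioc_of_le hl] at h
  exact ((hasFiniteIntegral_iff_ofReal ((ae_restrict_iff' measurableSet_Ioc).2
    (Eventually.of_forall fun t ht => Real.rpow_nonneg ht.1.le _))).1 h.2).ne

theorem lintegral_rlKernel_left_le (α : ℝ) {c d x : ℝ} (hx : x ∈ Set.Ioo c d) :
    ∫⁻ w in Set.Ioo c d, ENNReal.ofReal (rlKernel α (x - w)) ≤ rlMass α (d - c) := by
  rw [rlMass, ← lintegral_indicator measurableSet_Ioc, ← lintegral_indicator measurableSet_Ioo,
    ← lintegral_sub_left_eq_self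
      ((Set.Ioc 0 (d - c)).indicator fun t => ENNReal.ofReal (t ^ (α - 1))) x]
  refine lintegral_mono fun w => ?_
  by_cases hw : w ∈ Set.Ioo c d
  · rw [Set.indicator_of_mem hw]
    rcases le_or_gt (x - w) 0 with h | h
    · simp [rlKernel_of_nonpos α h]
    · rw [Set.indicator_of_mem (Set.mem_Ioc.2 ⟨h, by linarith [hw.1, hx.2]⟩), rlKernel_of_pos α h]
  · rw [Set.indicator_of_notMem hw]; exact zero_le

theorem lintegral_rlKernel_right_le (α : ℝ) {c d x : ℝ} (hx : x ∈ Set.Ioo c d) :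
    ∫⁻ w in Set.Ioo c d, ENNReal.ofReal (rlKernel α (w - x)) ≤ rlMass α (d - c) := by
  rw [rlMass, ← lintegral_indicator measurableSet_Ioc, ← lintegral_indicator measurableSet_Ioo,
    ← lintegral_sub_right_eq_self
      ((Set.Ioc 0 (d - c)).indicator fun t => ENNReal.ofReal (t ^ (α - 1))) x]
  refine lintegral_mono fun w => ?_
  by_cases hw : w ∈ Set.Ioo c d
  · rw [Set.indicator_of_mem hw]
    rcases le_or_gt (w - x) 0 with h | h
    · simp [rlKernel_of_nonpos α h]
    · rw [Set.indicator_of_mem (Set.mem_Ioc.2 ⟨h, by linarith [hw.2, hx.1]⟩), rlKernel_of_pos α h]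
  · rw [Set.indicator_of_notMem hw]; exact zero_le

/-- The indicator function of the window `(z, z + h)`, where `q = (h, z)`. -/
noncomputable def window (q : ℝ × ℝ) (x : ℝ) : ℝ :=
  (Set.Ioo q.2 (q.2 + q.1)).indicator (fun _ => 1) x

theorem window_nonneg (q : ℝ × ℝ) (x : ℝ) : 0 ≤ window q x :=
  Set.indicator_nonneg (fun _ _ => zero_le_one) x

theorem measurable_window : Measurable fun z : (ℝ × ℝ) × ℝ => window z.1 z.2 := by
  have : (fun z : (ℝ × ℝ) × ℝ => window z.1 z.2)
      = {z : (ℝ × ℝ) × ℝ | z.1.2 < z.2 ∧ z.2 < z.1.2 + z.1.1}.indicator fun _ => 1 := by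
    ext z
    simp [window, Set.indicator, Set.mem_Ioo]
  rw [this]
  have h1 : MeasurableSet {z : (ℝ × ℝ) × ℝ | z.1.2 < z.2} :=
    measurableSet_lt (by fun_prop) (by fun_prop)
  have h2 : MeasurableSet {z : (ℝ × ℝ) × ℝ | z.2 < z.1.2 + z.1.1} :=
    measurableSet_lt (by fun_prop) (by fun_prop)
  exact measurable_const.indicator (h1.inter h2)

/-- The windows of width `h` containing both points start in `(max x y - h, min x y)`. If `h ≤ |x -
y|` there is none, and `ENNReal.ofReal` truncates to zero. -/
theorem lintegral_window_mul_window (h x y : ℝ) :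
    ∫⁻ z, ENNReal.ofReal (window (h, z) x * window (h, z) y) = ENNReal.ofReal (h - |x - y|) := by
  have : (fun z => ENNReal.ofReal (window (h, z) x * window (h, z) y))
      = (Set.Ioo (max x y - h) (min x y)).indicator fun _ => 1 := by
    ext z
    by_cases h1 : z ∈ Set.Ioo (max x y - h) (min x y)
    · have h2 := h1
      simp only [Set.mem_Ioo, sub_lt_iff_lt_add, max_lt_iff, lt_min_iff] at h2
      rw [Set.indicator_of_mem h1, window, window, Set.indicator_of_mem, Set.indicator_of_mem]
      · simp
      · exact ⟨h2.2.2, h2.1.2⟩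
      · exact ⟨h2.2.1, h2.1.1⟩
    · rw [Set.indicator_of_notMem h1]
      simp only [Set.mem_Ioo, sub_lt_iff_lt_add, max_lt_iff, lt_min_iff] at h1
      by_cases hx : x ∈ Set.Ioo z (z + h)
      · have hy : y ∉ Set.Ioo z (z + h) := fun hy => h1 ⟨⟨hx.2, hy.2⟩, hx.1, hy.1⟩
        simp [window, Set.indicator_of_notMem hy]
      · simp [window, Set.indicator_of_notMem hx]
  rw [this, lintegral_indicator measurableSet_Ioo]
  simp only [lintegral_const, one_mul, Measure.restrict_apply_univ, Real.volume_Ioo]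
  congr 1
  rcases le_total x y with h | h
  · rw [max_eq_right h, min_eq_left h, abs_of_nonpos (by linarith)]; ring
  · rw [max_eq_left h, min_eq_right h, abs_of_nonneg (by linarith)]; ring

/-- The value of `∫₁^∞ h ^ (α - 3) (h - 1) dh`. -/
noncomputable def tentConst (α : ℝ) : ℝ := (1 - α)⁻¹ - (2 - α)⁻¹

theorem tentConst_pos {α : ℝ} (hα : α < 1) : 0 < tentConst α :=
  sub_pos.2 (inv_strictAnti₀ (by linarith) (by linarith))

/-- The exponent `α - 3` is dictated by scaling: integrating a tent of height `h - r` against it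
yields the power `r ^ (α - 1)`. Convergence at infinity is where `α < 1` enters. -/
theorem lintegral_rpow_mul_sub {α r : ℝ} (hα : α < 1) (hr : 0 < r) :
    ∫⁻ h in Set.Ioi (0 : ℝ), ENNReal.ofReal (h ^ (α - 3)) * ENNReal.ofReal (h - r)
      = ENNReal.ofReal (tentConst α * r ^ (α - 1)) := by
  have h1 : ∫⁻ h in Set.Ioi (0 : ℝ), ENNReal.ofReal (h ^ (α - 3)) * ENNReal.ofReal (h - r)
      = ∫⁻ h in Set.Ioi r, ENNReal.ofReal (h ^ (α - 2) - r * h ^ (α - 3)) := by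
    rw [← lintegral_indicator measurableSet_Ioi, ← lintegral_indicator measurableSet_Ioi]
    congr 1
    ext h
    by_cases hh : h ∈ Set.Ioi r
    · have h0 : 0 < h := hr.trans hh
      rw [Set.indicator_of_mem hh, Set.indicator_of_mem (Set.mem_Ioi.2 h0),
        ← ENNReal.ofReal_mul (Real.rpow_nonneg h0.le _)]
      congr 1
      rw [show α - 2 = α - 3 + 1 by ring, Real.rpow_add_one h0.ne']; ring
    · rw [Set.indicator_of_notMem hh]
      by_cases h0 : h ∈ Set.Ioi (0 : ℝ)
      · rw [Set.indicator_of_mem h0, ENNReal.ofReal_of_nonpos (p := h - r)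
          (by simpa using hh), mul_zero]
      · rw [Set.indicator_of_notMem h0]
  have i2 : IntegrableOn (fun h : ℝ => h ^ (α - 2)) (Set.Ioi r) :=
    integrableOn_Ioi_rpow_of_lt (by linarith) hr
  have i3 : IntegrableOn (fun h : ℝ => r * h ^ (α - 3)) (Set.Ioi r) :=
    (integrableOn_Ioi_rpow_of_lt (by linarith) hr).const_mul r
  have i4 : IntegrableOn (fun h : ℝ => h ^ (α - 2) - r * h ^ (α - 3)) (Set.Ioi r) := i2.sub i3
  rw [h1, ← ofReal_integral_eq_lintegral_ofReal i4]
  · congr 1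
    rw [integral_sub i2 i3, integral_const_mul, integral_Ioi_rpow_of_lt (by linarith) hr,
      integral_Ioi_rpow_of_lt (by linarith) hr, show α - 3 + 1 = α - 2 by ring,
      show α - 2 + 1 = α - 1 by ring, tentConst, show α - 1 = α - 2 + 1 by ring,
      Real.rpow_add_one hr.ne']
    have e1 : (1 - α) ≠ 0 := by linarith
    have e2 : (2 - α) ≠ 0 := by linarith
    have e3 : (α - 2 + 1) ≠ 0 := by intro h; apply e1; linarith
    have e4 : (α - 2) ≠ 0 := by intro h; apply e2; linarith
    field_simp
    ring
  · refine (ae_restrict_iff' measurableSet_Ioi).2 (Eventually.of_forall fun h hh => ?_)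
    have h0 : 0 < h := hr.trans hh
    have : h ^ (α - 2) - r * h ^ (α - 3) = h ^ (α - 3) * (h - r) := by
      rw [show α - 2 = α - 3 + 1 by ring, Real.rpow_add_one h0.ne']; ring
    simp only [Pi.zero_apply, this]
    exact mul_nonneg (Real.rpow_nonneg h0.le _) (sub_nonneg.2 (le_of_lt hh))

/-- Lebesgue measure on the set of pairs (width, left end point) of windows. -/
noncomputable def windowMeasure : Measure (ℝ × ℝ) :=
  (volume.restrict (Set.Ioi (0 : ℝ))).prod volume

instance : SFinite windowMeasure := by unfold windowMeasure; infer_instance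

theorem ae_windowMeasure_pos : ∀ᵐ q ∂windowMeasure, 0 < q.1 :=
  (Measure.quasiMeasurePreserving_fst (ν := (volume : Measure ℝ))).ae
    (ae_restrict_mem (measurableSet_Ioi (a := (0 : ℝ))))

theorem measurable_window_left (x : ℝ) : Measurable fun q => window q x :=
  measurable_window.comp (measurable_id.prodMk measurable_const)

theorem measurable_windowDensity (α x y : ℝ) :
    Measurable fun q : ℝ × ℝ => q.1 ^ (α - 3) * (window q x * window q y) :=
  (measurable_fst.pow_const _).mul ((measurable_window_left x).mul (measurable_window_left y))

theorem windowDensity_nonneg_ae (α x y : ℝ) :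
    ∀ᵐ q ∂windowMeasure, 0 ≤ q.1 ^ (α - 3) * (window q x * window q y) := by
  filter_upwards [ae_windowMeasure_pos] with q hq
  exact mul_nonneg (Real.rpow_nonneg hq.le _)
    (mul_nonneg (window_nonneg _ _) (window_nonneg _ _))

/-- The representation of the Riesz kernel as a positive superposition of windows, from which
positive definiteness follows. On the diagonal the left side is infinite, hence `x ≠ y`; the
diagonal is a null set in all later uses. -/
theorem lintegral_windowDensity {α x y : ℝ} (hα : α < 1) (hxy : x ≠ y) :
    ∫⁻ q, ENNReal.ofReal (q.1 ^ (α - 3) * (window q x * window q y)) ∂windowMeasure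
      = ENNReal.ofReal (tentConst α * (rlKernel α (x - y) + rlKernel α (y - x))) := by
  rw [rlKernel_add_rlKernel hxy, ← lintegral_rpow_mul_sub hα (abs_pos.2 (sub_ne_zero.2 hxy)),
    windowMeasure, lintegral_prod _ (measurable_windowDensity α x y).ennreal_ofReal.aemeasurable]
  refine setLIntegral_congr_fun measurableSet_Ioi fun h hh => ?_
  have h0 : (0 : ℝ) ≤ h ^ (α - 3) := Real.rpow_nonneg (le_of_lt hh) _
  simp only [ENNReal.ofReal_mul h0]
  rw [lintegral_const_mul' _ _ ENNReal.ofReal_ne_top, lintegral_window_mul_window]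

theorem integrable_windowDensity {α x y : ℝ} (hα : α < 1) (hxy : x ≠ y) :
    Integrable (fun q : ℝ × ℝ => q.1 ^ (α - 3) * (window q x * window q y)) windowMeasure := by
  refine ⟨(measurable_windowDensity α x y).aestronglyMeasurable, ?_⟩
  rw [hasFiniteIntegral_iff_ofReal (windowDensity_nonneg_ae α x y),
    lintegral_windowDensity hα hxy]
  exact ENNReal.ofReal_lt_top

theorem integral_windowDensity {α x y : ℝ} (hα : α < 1) (hxy : x ≠ y) :
    ∫ q : ℝ × ℝ, q.1 ^ (α - 3) * (window q x * window q y) ∂windowMeasure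
      = tentConst α * (rlKernel α (x - y) + rlKernel α (y - x)) := by
  rw [integral_eq_lintegral_of_nonneg_ae (windowDensity_nonneg_ae α x y)
    (measurable_windowDensity α x y).aestronglyMeasurable, lintegral_windowDensity hα hxy,
    ENNReal.toReal_ofReal]
  exact mul_nonneg (tentConst_pos hα).le
    (add_nonneg (rlKernel_nonneg _ _) (rlKernel_nonneg _ _))

end Kernel

/-! ### Positive definiteness of the Riesz kernel on an interval -/

section Energy

variable {α c d : ℝ} {f : ℝ → ℝ}

/-- The symmetrised Riemann-Liouville kernel. -/
noncomputable def rieszKernel (α : ℝ) (z : ℝ × ℝ) : ℝ :=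
  rlKernel α (z.1 - z.2) + rlKernel α (z.2 - z.1)

theorem measurable_rieszKernel (α : ℝ) : Measurable (rieszKernel α) :=
  ((measurable_rlKernel α).comp (measurable_fst.sub measurable_snd)).add
    ((measurable_rlKernel α).comp (measurable_snd.sub measurable_fst))

theorem rieszKernel_nonneg (α : ℝ) (z : ℝ × ℝ) : 0 ≤ rieszKernel α z :=
  add_nonneg (rlKernel_nonneg _ _) (rlKernel_nonneg _ _)

theorem lintegral_rieszKernel_le (α : ℝ) {x : ℝ} (hx : x ∈ Set.Ioo c d) :
    ∫⁻ w in Set.Ioo c d, ENNReal.ofReal (rieszKernel α (x, w)) ≤ 2 * rlMass α (d - c) := by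
  simp only [rieszKernel, ENNReal.ofReal_add (rlKernel_nonneg _ _) (rlKernel_nonneg _ _)]
  rw [lintegral_add_left (show Measurable fun w => ENNReal.ofReal (rlKernel α (x - w)) from
    ((measurable_rlKernel α).comp (measurable_const.sub measurable_id)).ennreal_ofReal), two_mul]
  exact add_le_add (lintegral_rlKernel_left_le α hx) (lintegral_rlKernel_right_le α hx)

theorem integrable_rieszKernel_mul (hα : 0 < α) (hcd : c < d) (hf : Measurable f)
    (hf2 : MemLp f 2 (volume.restrict (Set.Ioo c d))) :
    Integrable (fun z : ℝ × ℝ => rieszKernel α z * (f z.1 * f z.2))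
      ((volume.restrict (Set.Ioo c d)).prod (volume.restrict (Set.Ioo c d))) := by
  have hK : ∀ᵐ x ∂volume.restrict (Set.Ioo c d),
      ∫⁻ w in Set.Ioo c d, ENNReal.ofReal (rieszKernel α (x, w)) ≤ 2 * rlMass α (d - c) := by
    filter_upwards [ae_restrict_mem measurableSet_Ioo] with x hx
    exact lintegral_rieszKernel_le α hx
  have hs : ∀ z, rieszKernel α (Prod.swap z) = rieszKernel α z := fun z => add_comm _ _
  exact integrable_kernel_mul_mul (T := Prod.swap) Measure.measurePreserving_swap
    Prod.swap_swap (measurable_rieszKernel α) (rieszKernel_nonneg α)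
    (ENNReal.mul_ne_top ENNReal.ofNat_ne_top (rlMass_ne_top hα (sub_nonneg.2 hcd.le))) hK
    (by simpa only [hs] using hK) hf hf2

theorem ae_ne_prod (μ ν : Measure ℝ) [SFinite ν] [NullSingletonClass ν] :
    ∀ᵐ z ∂μ.prod ν, z.1 ≠ z.2 := by
  refine (Measure.ae_prod_iff_ae_ae ?_).2 (Eventually.of_forall fun x => ?_)
  · exact (measurableSet_eq_fun measurable_fst measurable_snd).compl
  · filter_upwards [compl_mem_ae_iff.2 (measure_singleton (μ := ν) x)] with y hy
    exact fun h => hy h.symm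

/-- The absolute integrability that justifies Fubini below. The density is nonnegative, so
integrating the norm over the windows reproduces the Riesz kernel times `|f x f y|`, which the Schur
test controls. -/
theorem integrable_energy_window (hα0 : 0 < α) (hα1 : α < 1) (hcd : c < d) (hf : Measurable f)
    (hf2 : MemLp f 2 (volume.restrict (Set.Ioo c d))) :
    Integrable (fun z : (ℝ × ℝ) × (ℝ × ℝ) =>
        z.2.1 ^ (α - 3) * (window z.2 z.1.1 * window z.2 z.1.2) * (f z.1.1 * f z.1.2))
      (((volume.restrict (Set.Ioo c d)).prod (volume.restrict (Set.Ioo c d))).prod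
        windowMeasure) := by
  have hm : Measurable fun z : (ℝ × ℝ) × (ℝ × ℝ) =>
        z.2.1 ^ (α - 3) * (window z.2 z.1.1 * window z.2 z.1.2) * (f z.1.1 * f z.1.2) := by
    have h1 : Measurable fun z : (ℝ × ℝ) × (ℝ × ℝ) => window z.2 z.1.1 :=
      measurable_window.comp (measurable_snd.prodMk (measurable_fst.comp measurable_fst))
    have h2 : Measurable fun z : (ℝ × ℝ) × (ℝ × ℝ) => window z.2 z.1.2 :=
      measurable_window.comp (measurable_snd.prodMk (measurable_snd.comp measurable_fst))
    exact (((measurable_fst.comp measurable_snd).pow_const _).mul (h1.mul h2)).mul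
      ((hf.comp (measurable_fst.comp measurable_fst)).mul
        (hf.comp (measurable_snd.comp measurable_fst)))
  have hne := ae_ne_prod (volume.restrict (Set.Ioo c d)) (volume.restrict (Set.Ioo c d))
  rw [integrable_prod_iff hm.aestronglyMeasurable]
  constructor
  · filter_upwards [hne] with z hz
    exact (integrable_windowDensity hα1 hz).mul_const _
  · refine ((integrable_rieszKernel_mul hα0 hcd hf hf2).norm.const_mul (tentConst α)).congr ?_
    filter_upwards [hne] with z hz
    have : (fun q : ℝ × ℝ => ‖q.1 ^ (α - 3) * (window q z.1 * window q z.2) * (f z.1 * f z.2)‖)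
        =ᵐ[windowMeasure] fun q =>
          q.1 ^ (α - 3) * (window q z.1 * window q z.2) * ‖f z.1 * f z.2‖ := by
      filter_upwards [windowDensity_nonneg_ae α z.1 z.2] with q hq
      rw [norm_mul, Real.norm_of_nonneg hq]
    rw [integral_congr_ae this, integral_mul_const, integral_windowDensity hα1 hz, norm_mul,
      Real.norm_of_nonneg (rieszKernel_nonneg α z), rieszKernel, mul_assoc]

theorem integral_window_eq (q : ℝ × ℝ) :
    ∫ z : ℝ × ℝ, q.1 ^ (α - 3) * (window q z.1 * window q z.2) * (f z.1 * f z.2)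
      ∂((volume.restrict (Set.Ioo c d)).prod (volume.restrict (Set.Ioo c d)))
      = q.1 ^ (α - 3) * (∫ x in Set.Ioo c d, window q x * f x) ^ 2 := by
  rw [sq, ← integral_prod_mul, ← integral_const_mul]
  congr 1
  ext z
  ring

/-- Fubini: integrating over the windows first gives the kernel, integrating over the points first
gives a perfect square for each window. -/
theorem tentConst_mul_energy (hα0 : 0 < α) (hα1 : α < 1) (hcd : c < d) (hf : Measurable f)
    (hf2 : MemLp f 2 (volume.restrict (Set.Ioo c d))) :
    tentConst α * ∫ z : ℝ × ℝ, rieszKernel α z * (f z.1 * f z.2)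
        ∂((volume.restrict (Set.Ioo c d)).prod (volume.restrict (Set.Ioo c d)))
      = ∫ q, q.1 ^ (α - 3) * (∫ x in Set.Ioo c d, window q x * f x) ^ 2 ∂windowMeasure := by
  have hI := integrable_energy_window hα0 hα1 hcd hf hf2
  have h1 := integral_prod _ hI
  rw [integral_prod_symm _ hI] at h1
  simp only [integral_window_eq] at h1
  rw [h1, ← integral_const_mul]
  refine integral_congr_ae ?_
  filter_upwards [ae_ne_prod (volume.restrict (Set.Ioo c d)) (volume.restrict (Set.Ioo c d))]
    with z hz
  rw [integral_mul_const, integral_windowDensity hα1 hz, rieszKernel, mul_assoc]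

theorem energy_nonneg (hα0 : 0 < α) (hα1 : α < 1) (hcd : c < d) (hf : Measurable f)
    (hf2 : MemLp f 2 (volume.restrict (Set.Ioo c d))) :
    0 ≤ ∫ z : ℝ × ℝ, rieszKernel α z * (f z.1 * f z.2)
        ∂((volume.restrict (Set.Ioo c d)).prod (volume.restrict (Set.Ioo c d))) := by
  refine nonneg_of_mul_nonneg_right ?_ (tentConst_pos hα1)
  rw [tentConst_mul_energy hα0 hα1 hcd hf hf2]
  refine integral_nonneg_of_ae ?_
  filter_upwards [ae_windowMeasure_pos] with q hq
  exact mul_nonneg (Real.rpow_nonneg hq.le _) (sq_nonneg _)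

/-- Window integrals are increments of a continuous primitive `Φ`, so almost all windows can be
upgraded to all windows. Then `Φ` is constant, and Lebesgue differentiation recovers `f = 0`. -/
theorem ae_eq_zero_of_integral_window (hf : IntegrableOn f (Set.Ioo c d))
    (h : ∀ᵐ q ∂windowMeasure, ∫ x in Set.Ioo c d, window q x * f x = 0) :
    f =ᵐ[volume.restrict (Set.Ioo c d)] 0 := by
  set F := (Set.Ioo c d).indicator f with hF
  have hFi : Integrable F := hf.integrable_indicator measurableSet_Ioo
  set Φ : ℝ → ℝ := fun t => ∫ x in (0 : ℝ)..t, F x with hΦ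
  have hΦc : Continuous Φ :=
    intervalIntegral.continuous_primitive (fun _ _ => hFi.intervalIntegrable) 0
  have hwin : ∀ q : ℝ × ℝ, 0 < q.1 →
      ∫ x in Set.Ioo c d, window q x * f x = Φ (q.2 + q.1) - Φ q.2 := by
    intro q hq
    rw [hΦ, intervalIntegral.integral_interval_sub_left hFi.intervalIntegrable
      hFi.intervalIntegrable, intervalIntegral.integral_of_le (by linarith),
      integral_Ioc_eq_integral_Ioo, ← integral_indicator measurableSet_Ioo,
      ← integral_indicator measurableSet_Ioo]
    congr 1
    ext x
    by_cases h1 : x ∈ Set.Ioo c d <;> by_cases h2 : x ∈ Set.Ioo q.2 (q.2 + q.1) <;>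
      simp only [hF, window, Set.indicator_of_mem, Set.indicator_of_notMem, h1, h2, one_mul,
        zero_mul, not_false_eq_true]
  -- The exceptional windows form an open set by continuity of `Φ`; being null, it is empty.
  set U : Set (ℝ × ℝ) := {q | 0 < q.1} ∩ {q | Φ (q.2 + q.1) ≠ Φ q.2} with hU
  have hUo : IsOpen U :=
    (isOpen_lt continuous_const continuous_fst).inter
      (isOpen_ne_fun (hΦc.comp (continuous_snd.add continuous_fst)) (hΦc.comp continuous_snd))
  have hwm : windowMeasure = volume.restrict (Set.Ioi (0 : ℝ) ×ˢ (Set.univ : Set ℝ)) := by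
    rw [windowMeasure, Measure.volume_eq_prod, ← Measure.prod_restrict, Measure.restrict_univ]
  have hU0 : volume U = 0 := by
    have h1 : windowMeasure U = 0 := by
      refine measure_mono_null (fun q hq => ?_) h
      simp only [Set.mem_compl_iff, Set.mem_ofPred_eq, hwin q hq.1]
      exact sub_ne_zero.2 hq.2
    rwa [hwm, Measure.restrict_eq_self] at h1
    exact fun q hq => ⟨hq.1, Set.mem_univ _⟩
  have hUe : U = ∅ := hUo.measure_eq_zero_iff volume |>.1 hU0
  have hconst : ∀ s t, s < t → Φ t = Φ s := by
    intro s t hst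
    by_contra hne
    have : ((t - s, s) : ℝ × ℝ) ∈ U := ⟨sub_pos.2 hst, by simpa using hne⟩
    rw [hUe] at this
    exact this
  have hΦ0 : Φ = fun _ => Φ 0 := by
    ext t
    rcases lt_trichotomy t 0 with h | h | h
    · exact (hconst _ _ h).symm
    · rw [h]
    · exact hconst _ _ h
  have hF0 : ∀ᵐ x, F x = 0 := by
    filter_upwards [LocallyIntegrable.ae_hasDerivAt_integral hFi.locallyIntegrable] with x hx
    have h1 : HasDerivAt Φ (F x) x := hx 0
    rw [hΦ0] at h1
    exact h1.unique (hasDerivAt_const x (Φ 0))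
  refine (ae_restrict_iff' measurableSet_Ioo).2 ?_
  filter_upwards [hF0] with x hx hxm
  rwa [hF, Set.indicator_of_mem hxm] at hx

theorem ae_eq_zero_of_energy_eq_zero (hα0 : 0 < α) (hα1 : α < 1) (hcd : c < d)
    (hf : Measurable f) (hf2 : MemLp f 2 (volume.restrict (Set.Ioo c d)))
    (h : ∫ z : ℝ × ℝ, rieszKernel α z * (f z.1 * f z.2)
        ∂((volume.restrict (Set.Ioo c d)).prod (volume.restrict (Set.Ioo c d))) = 0) :
    f =ᵐ[volume.restrict (Set.Ioo c d)] 0 := by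
  have h1 := tentConst_mul_energy hα0 hα1 hcd hf hf2
  rw [h, mul_zero] at h1
  have hI := (integrable_energy_window hα0 hα1 hcd hf hf2).integral_prod_right
  simp only [integral_window_eq] at hI
  have h2 := (integral_eq_zero_iff_of_nonneg_ae (by
    filter_upwards [ae_windowMeasure_pos] with q hq
    exact mul_nonneg (Real.rpow_nonneg hq.le _) (sq_nonneg _)) hI).1 h1.symm
  refine ae_eq_zero_of_integral_window (hf2.integrable one_le_two) ?_
  filter_upwards [h2, ae_windowMeasure_pos] with q hq hq0
  have := (mul_eq_zero.1 hq).resolve_left (Real.rpow_pos_of_pos hq0 _).ne'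
  exact pow_eq_zero_iff two_ne_zero |>.1 this

end Energy

/-! ### Fractional integrals on the box -/

section FractionalIntegrals

variable {n : ℕ} {a b : Fin n → ℝ} {α : ℝ} {i : Fin n} {v v' : (Fin n → ℝ) → ℝ}

/-- The kernel of the left fractional integral, as a function on `Ω × (aᵢ, bᵢ)`. -/
noncomputable def leftKernel (α : ℝ) (i : Fin n) (z : (Fin n → ℝ) × ℝ) : ℝ :=
  rlKernel α (z.1 i - z.2)

/-- The kernel of the right fractional integral, as a function on `Ω × (aᵢ, bᵢ)`. -/
noncomputable def rightKernel (α : ℝ) (i : Fin n) (z : (Fin n → ℝ) × ℝ) : ℝ :=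
  rlKernel α (z.2 - z.1 i)

theorem measurable_leftKernel (α : ℝ) (i : Fin n) : Measurable (leftKernel α i) :=
  (measurable_rlKernel α).comp
    (((measurable_pi_apply i).comp measurable_fst).sub measurable_snd)

theorem measurable_rightKernel (α : ℝ) (i : Fin n) : Measurable (rightKernel α i) :=
  (measurable_rlKernel α).comp
    (measurable_snd.sub ((measurable_pi_apply i).comp measurable_fst))

theorem leftKernel_swapCoord (z : (Fin n → ℝ) × ℝ) :
    leftKernel α i (swapCoord i z) = rightKernel α i z := by
  simp [leftKernel, rightKernel, swapCoord]

theorem rightKernel_swapCoord (z : (Fin n → ℝ) × ℝ) :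
    rightKernel α i (swapCoord i z) = leftKernel α i z := by
  simp [leftKernel, rightKernel, swapCoord]

theorem ae_lintegral_leftKernel_le (a b : Fin n → ℝ) (α : ℝ) (i : Fin n) :
    ∀ᵐ x ∂boxMeasure a b, ∫⁻ w, ENNReal.ofReal (leftKernel α i (x, w)) ∂axisMeasure a b i
      ≤ rlMass α (b i - a i) := by
  filter_upwards [ae_mem_box a b] with x hx
  exact lintegral_rlKernel_left_le α (hx i (Set.mem_univ i))

theorem ae_lintegral_rightKernel_le (a b : Fin n → ℝ) (α : ℝ) (i : Fin n) :
    ∀ᵐ x ∂boxMeasure a b, ∫⁻ w, ENNReal.ofReal (rightKernel α i (x, w)) ∂axisMeasure a b i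
      ≤ rlMass α (b i - a i) := by
  filter_upwards [ae_mem_box a b] with x hx
  exact lintegral_rlKernel_right_le α (hx i (Set.mem_univ i))

/-- The kernel vanishes for `w ≥ xᵢ`, so the domain of integration can be made independent of `x`.
This puts the operator in the form required by the Schur test. -/
theorem leftInt_eq (hα : α ≠ 0) (v : (Fin n → ℝ) → ℝ) {x : Fin n → ℝ} (hx : x ∈ box a b) :
    leftInt a α i v x = (1 / Real.Gamma α) *
      ∫ w, leftKernel α i (x, w) * v (Function.update x i w) ∂axisMeasure a b i := by
  have hxi : x i ∈ Set.Ioo (a i) (b i) := hx i (Set.mem_univ i)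
  rw [leftInt, if_neg hα, intervalIntegral.integral_of_le hxi.1.le, integral_Ioc_eq_integral_Ioo,
    axisMeasure, ← integral_indicator measurableSet_Ioo, ← integral_indicator measurableSet_Ioo]
  congr 2
  ext w
  by_cases h1 : w ∈ Set.Ioo (a i) (x i)
  · rw [Set.indicator_of_mem h1, Set.indicator_of_mem (Set.mem_Ioo.2 ⟨h1.1, h1.2.trans hxi.2⟩),
      leftKernel, rlKernel_of_pos α (sub_pos.2 h1.2)]
  · rw [Set.indicator_of_notMem h1]
    by_cases h2 : w ∈ Set.Ioo (a i) (b i)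
    · rw [Set.indicator_of_mem h2, leftKernel, rlKernel_of_nonpos, zero_mul]
      exact sub_nonpos.2 (not_lt.1 fun h => h1 ⟨h2.1, h⟩)
    · rw [Set.indicator_of_notMem h2]

theorem rightInt_eq (hα : α ≠ 0) (v : (Fin n → ℝ) → ℝ) {x : Fin n → ℝ} (hx : x ∈ box a b) :
    rightInt b α i v x = (1 / Real.Gamma α) *
      ∫ w, rightKernel α i (x, w) * v (Function.update x i w) ∂axisMeasure a b i := by
  have hxi : x i ∈ Set.Ioo (a i) (b i) := hx i (Set.mem_univ i)
  rw [rightInt, if_neg hα, intervalIntegral.integral_of_le hxi.2.le,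
    integral_Ioc_eq_integral_Ioo,
    axisMeasure, ← integral_indicator measurableSet_Ioo, ← integral_indicator measurableSet_Ioo]
  congr 2
  ext w
  by_cases h1 : w ∈ Set.Ioo (x i) (b i)
  · rw [Set.indicator_of_mem h1, Set.indicator_of_mem (Set.mem_Ioo.2 ⟨hxi.1.trans h1.1, h1.2⟩),
      rightKernel, rlKernel_of_pos α (sub_pos.2 h1.1)]
  · rw [Set.indicator_of_notMem h1]
    by_cases h2 : w ∈ Set.Ioo (a i) (b i)
    · rw [Set.indicator_of_mem h2, rightKernel, rlKernel_of_nonpos, zero_mul]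
      exact sub_nonpos.2 (not_lt.1 fun h => h1 ⟨h, h2.2⟩)
    · rw [Set.indicator_of_notMem h2]

theorem leftInt_congr_ae (hα : α ≠ 0) (h : v =ᵐ[boxMeasure a b] v') :
    leftInt a α i v =ᵐ[boxMeasure a b] leftInt a α i v' := by
  filter_upwards [ae_mem_box a b, ae_ae_update i h] with x hx hx'
  rw [leftInt_eq hα v hx, leftInt_eq hα v' hx]
  congr 1
  refine integral_congr_ae ?_
  filter_upwards [hx'] with w hw
  rw [hw]

theorem rightInt_congr_ae (hα : α ≠ 0) (h : v =ᵐ[boxMeasure a b] v') :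
    rightInt b α i v =ᵐ[boxMeasure a b] rightInt b α i v' := by
  filter_upwards [ae_mem_box a b, ae_ae_update i h] with x hx hx'
  rw [rightInt_eq hα v hx, rightInt_eq hα v' hx]
  congr 1
  refine integral_congr_ae ?_
  filter_upwards [hx'] with w hw
  rw [hw]

theorem leftInt_ae_eq_zero (hα : α ≠ 0) (h : v =ᵐ[boxMeasure a b] 0) :
    leftInt a α i v =ᵐ[boxMeasure a b] 0 := by
  refine (leftInt_congr_ae hα h).trans (Eventually.of_forall fun x => ?_)
  simp [leftInt, hα]

theorem memLp_leftInt (hα : 0 < α) (hab : a i < b i) (hv : MemLp v 2 (boxMeasure a b)) :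
    MemLp (leftInt a α i v) 2 (boxMeasure a b) := by
  obtain ⟨v', hv', hvv'⟩ := hv.1
  have h := memLp_two_integral_kernel_mul (measurePreserving_swapCoord a b i)
    (swapCoord_swapCoord i) (measurable_leftKernel α i) (fun z => rlKernel_nonneg _ _)
    (rlMass_ne_top hα (sub_nonneg.2 hab.le)) (ae_lintegral_leftKernel_le a b α i)
    (by simpa only [leftKernel_swapCoord] using ae_lintegral_rightKernel_le a b α i)
    hv'.measurable ((memLp_congr_ae hvv').1 hv)
  refine (memLp_congr_ae ?_).2 (h.const_mul (1 / Real.Gamma α))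
  filter_upwards [leftInt_congr_ae (i := i) hα.ne' hvv', ae_mem_box a b] with x hx hxb
  rw [hx, leftInt_eq hα.ne' _ hxb]
  rfl

theorem memLp_rightInt (hα : 0 < α) (hab : a i < b i) (hv : MemLp v 2 (boxMeasure a b)) :
    MemLp (rightInt b α i v) 2 (boxMeasure a b) := by
  obtain ⟨v', hv', hvv'⟩ := hv.1
  have h := memLp_two_integral_kernel_mul (measurePreserving_swapCoord a b i)
    (swapCoord_swapCoord i) (measurable_rightKernel α i) (fun z => rlKernel_nonneg _ _)
    (rlMass_ne_top hα (sub_nonneg.2 hab.le)) (ae_lintegral_rightKernel_le a b α i)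
    (by simpa only [rightKernel_swapCoord] using ae_lintegral_leftKernel_le a b α i)
    hv'.measurable ((memLp_congr_ae hvv').1 hv)
  refine (memLp_congr_ae ?_).2 (h.const_mul (1 / Real.Gamma α))
  filter_upwards [rightInt_congr_ae (i := i) hα.ne' hvv', ae_mem_box a b] with x hx hxb
  rw [hx, rightInt_eq hα.ne' _ hxb]
  rfl

theorem ae_integrable_leftKernel_mul (hα : 0 < α) (hab : a i < b i)
    (hv : MemLp v 2 (boxMeasure a b)) :
    ∀ᵐ x ∂boxMeasure a b, Integrable
      (fun w => leftKernel α i (x, w) * v (Function.update x i w)) (axisMeasure a b i) := by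
  obtain ⟨v', hv', hvv'⟩ := hv.1
  have h := ae_integrable_kernel_mul (measurePreserving_swapCoord a b i)
    (swapCoord_swapCoord i) (measurable_leftKernel α i) (fun z => rlKernel_nonneg _ _)
    (rlMass_ne_top hα (sub_nonneg.2 hab.le)) (ae_lintegral_leftKernel_le a b α i)
    (by simpa only [leftKernel_swapCoord] using ae_lintegral_rightKernel_le a b α i)
    hv'.measurable ((memLp_congr_ae hvv').1 hv)
  filter_upwards [h, ae_ae_update i hvv'] with x hx hx'
  refine hx.congr ?_
  filter_upwards [hx'] with w hw
  rw [hw]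
  rfl

theorem ae_integrable_rightKernel_mul (hα : 0 < α) (hab : a i < b i)
    (hv : MemLp v 2 (boxMeasure a b)) :
    ∀ᵐ x ∂boxMeasure a b, Integrable
      (fun w => rightKernel α i (x, w) * v (Function.update x i w)) (axisMeasure a b i) := by
  obtain ⟨v', hv', hvv'⟩ := hv.1
  have h := ae_integrable_kernel_mul (measurePreserving_swapCoord a b i)
    (swapCoord_swapCoord i) (measurable_rightKernel α i) (fun z => rlKernel_nonneg _ _)
    (rlMass_ne_top hα (sub_nonneg.2 hab.le)) (ae_lintegral_rightKernel_le a b α i)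
    (by simpa only [rightKernel_swapCoord] using ae_lintegral_leftKernel_le a b α i)
    hv'.measurable ((memLp_congr_ae hvv').1 hv)
  filter_upwards [h, ae_ae_update i hvv'] with x hx hx'
  refine hx.congr ?_
  filter_upwards [hx'] with w hw
  rw [hw]
  rfl

theorem leftInt_sub_ae (hα : 0 < α) (hab : a i < b i) (hv : MemLp v 2 (boxMeasure a b))
    (hv' : MemLp v' 2 (boxMeasure a b)) :
    leftInt a α i (v - v') =ᵐ[boxMeasure a b] leftInt a α i v - leftInt a α i v' := by
  filter_upwards [ae_mem_box a b, ae_integrable_leftKernel_mul hα hab hv,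
    ae_integrable_leftKernel_mul hα hab hv'] with x hx h h'
  rw [Pi.sub_apply, leftInt_eq hα.ne' _ hx, leftInt_eq hα.ne' _ hx, leftInt_eq hα.ne' _ hx,
    ← mul_sub, ← integral_sub h h']
  simp only [Pi.sub_apply, mul_sub]

theorem rightInt_sub_ae (hα : 0 < α) (hab : a i < b i) (hv : MemLp v 2 (boxMeasure a b))
    (hv' : MemLp v' 2 (boxMeasure a b)) :
    rightInt b α i (v - v') =ᵐ[boxMeasure a b] rightInt b α i v - rightInt b α i v' := by
  filter_upwards [ae_mem_box a b, ae_integrable_rightKernel_mul hα hab hv,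
    ae_integrable_rightKernel_mul hα hab hv'] with x hx h h'
  rw [Pi.sub_apply, rightInt_eq hα.ne' _ hx, rightInt_eq hα.ne' _ hx, rightInt_eq hα.ne' _ hx,
    ← mul_sub, ← integral_sub h h']
  simp only [Pi.sub_apply, mul_sub]

/-! ### Coercivity -/

theorem integrable_leftKernel_mul_mul (hα : 0 < α) (hab : a i < b i) (hm : Measurable v)
    (hv : MemLp v 2 (boxMeasure a b)) :
    Integrable (fun z => leftKernel α i z * (v z.1 * v (swapCoord i z).1))
      ((boxMeasure a b).prod (axisMeasure a b i)) :=
  integrable_kernel_mul_mul (measurePreserving_swapCoord a b i)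
    (swapCoord_swapCoord i) (measurable_leftKernel α i) (fun z => rlKernel_nonneg _ _)
    (rlMass_ne_top hα (sub_nonneg.2 hab.le)) (ae_lintegral_leftKernel_le a b α i)
    (by simpa only [leftKernel_swapCoord] using ae_lintegral_rightKernel_le a b α i) hm hv

theorem integrable_rightKernel_mul_mul (hα : 0 < α) (hab : a i < b i) (hm : Measurable v)
    (hv : MemLp v 2 (boxMeasure a b)) :
    Integrable (fun z => rightKernel α i z * (v z.1 * v (swapCoord i z).1))
      ((boxMeasure a b).prod (axisMeasure a b i)) :=
  integrable_kernel_mul_mul (measurePreserving_swapCoord a b i)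
    (swapCoord_swapCoord i) (measurable_rightKernel α i) (fun z => rlKernel_nonneg _ _)
    (rlMass_ne_top hα (sub_nonneg.2 hab.le)) (ae_lintegral_rightKernel_le a b α i)
    (by simpa only [rightKernel_swapCoord] using ae_lintegral_leftKernel_le a b α i) hm hv

/-- Adjointness of the two fractional integrals: the swap exchanges the kernels and fixes the
symmetric product `v z.1 * v (swapCoord i z).1`. This is why `pᵢ` and `qᵢ` enter only through their
sum. -/
theorem integral_leftKernel_eq_rightKernel :
    ∫ z, leftKernel α i z * (v z.1 * v (swapCoord i z).1)
        ∂((boxMeasure a b).prod (axisMeasure a b i))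
      = ∫ z, rightKernel α i z * (v z.1 * v (swapCoord i z).1)
        ∂((boxMeasure a b).prod (axisMeasure a b i)) := by
  have he : MeasurableEmbedding (swapCoord i) :=
    MeasurableEquiv.measurableEmbedding
      (⟨⟨swapCoord i, swapCoord i, swapCoord_swapCoord i, swapCoord_swapCoord i⟩,
        measurable_swapCoord i, measurable_swapCoord i⟩ : _ ≃ᵐ _)
  rw [← (measurePreserving_swapCoord a b i).integral_comp he]
  simp only [leftKernel_swapCoord, swapCoord_swapCoord]
  congr 1
  ext z
  ring

theorem integral_leftInt_mul (hα : 0 < α) (hab : a i < b i) (hm : Measurable v)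
    (hv : MemLp v 2 (boxMeasure a b)) :
    ∫ x, leftInt a α i v x * v x ∂boxMeasure a b = (1 / Real.Gamma α) *
      ∫ z, leftKernel α i z * (v z.1 * v (swapCoord i z).1)
        ∂((boxMeasure a b).prod (axisMeasure a b i)) := by
  rw [integral_prod _ (integrable_leftKernel_mul_mul hα hab hm hv), ← integral_const_mul]
  refine integral_congr_ae ?_
  filter_upwards [ae_mem_box a b] with x hx
  rw [leftInt_eq hα.ne' v hx, mul_assoc, ← integral_mul_const]
  congr 2
  ext w
  simp only [swapCoord]
  ring

theorem integral_rightInt_mul (hα : 0 < α) (hab : a i < b i) (hm : Measurable v)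
    (hv : MemLp v 2 (boxMeasure a b)) :
    ∫ x, rightInt b α i v x * v x ∂boxMeasure a b = (1 / Real.Gamma α) *
      ∫ z, rightKernel α i z * (v z.1 * v (swapCoord i z).1)
        ∂((boxMeasure a b).prod (axisMeasure a b i)) := by
  rw [integral_prod _ (integrable_rightKernel_mul_mul hα hab hm hv), ← integral_const_mul]
  refine integral_congr_ae ?_
  filter_upwards [ae_mem_box a b] with x hx
  rw [rightInt_eq hα.ne' v hx, mul_assoc, ← integral_mul_const]
  congr 2
  ext w
  simp only [swapCoord]
  ring

theorem ae_memLp_slice (hm : Measurable v) (hv : MemLp v 2 (boxMeasure a b)) :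
    ∀ᵐ x ∂boxMeasure a b, MemLp (fun w => v (Function.update x i w)) 2 (axisMeasure a b i) := by
  have h1 : Integrable (fun z : (Fin n → ℝ) × ℝ => v z.1 ^ 2)
      ((boxMeasure a b).prod (axisMeasure a b i)) := hv.integrable_sq.comp_fst _
  have h2 := (measurePreserving_swapCoord a b i).integrable_comp_of_integrable h1
  filter_upwards [h2.prod_right_ae] with x hx
  have hmx : Measurable fun w => v (Function.update x i w) :=
    hm.comp ((measurable_updateCoord i).comp measurable_prodMk_left)
  exact (memLp_two_iff_integrable_sq hmx.aestronglyMeasurable).2 hx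

/-- The energy of the slice of `v` through `x` in the `i`-th direction. -/
noncomputable def sliceEnergy (a b : Fin n → ℝ) (α : ℝ) (i : Fin n) (v : (Fin n → ℝ) → ℝ)
    (x : Fin n → ℝ) : ℝ :=
  ∫ z : ℝ × ℝ, rieszKernel α z * (v (Function.update x i z.1) * v (Function.update x i z.2))
    ∂((axisMeasure a b i).prod (axisMeasure a b i))

/-- The slice energy does not depend on `xᵢ`, so integrating it over the box counts each line with
weight `bᵢ - aᵢ`. The factor `2` appears because the Riesz kernel is the sum of the left and the
right kernel, which contribute equally. -/
theorem integral_sliceEnergy (hα : 0 < α) (hab : a i < b i) (hm : Measurable v)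
    (hv : MemLp v 2 (boxMeasure a b)) :
    Integrable (sliceEnergy a b α i v) (boxMeasure a b) ∧
    ∫ x, sliceEnergy a b α i v x ∂boxMeasure a b = 2 * (b i - a i) *
      ∫ z, leftKernel α i z * (v z.1 * v (swapCoord i z).1)
        ∂((boxMeasure a b).prod (axisMeasure a b i)) := by
  set M := (boxMeasure a b).prod (axisMeasure a b i)
  set R : (Fin n → ℝ) × ℝ → ℝ := fun z => leftKernel α i z * (v z.1 * v (swapCoord i z).1)
    + rightKernel α i z * (v z.1 * v (swapCoord i z).1) with hR
  have hL := integrable_leftKernel_mul_mul hα hab hm hv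
  have hRt := integrable_rightKernel_mul_mul hα hab hm hv
  have hRi : Integrable R M := hL.add hRt
  have hRint : ∫ z, R z ∂M = 2 * ∫ z, leftKernel α i z * (v z.1 * v (swapCoord i z).1) ∂M := by
    rw [hR, integral_add hL hRt, ← integral_leftKernel_eq_rightKernel]; ring
  set r : (Fin n → ℝ) → ℝ := fun x => ∫ w, R (x, w) ∂axisMeasure a b i with hr
  have hri : Integrable r (boxMeasure a b) := hRi.integral_prod_left
  have hr1 : Integrable (fun z : (Fin n → ℝ) × ℝ => r z.1) M := hri.comp_fst _
  have hr2 : Integrable (fun z => r (swapCoord i z).1) M :=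
    (measurePreserving_swapCoord a b i).integrable_comp_of_integrable hr1
  have hslice : (fun x => ∫ w, r (swapCoord i (x, w)).1 ∂axisMeasure a b i)
      =ᵐ[boxMeasure a b] sliceEnergy a b α i v := by
    filter_upwards [ae_memLp_slice (i := i) hm hv] with x hx
    have hmx : Measurable fun w => v (Function.update x i w) :=
      hm.comp ((measurable_updateCoord i).comp measurable_prodMk_left)
    rw [sliceEnergy, axisMeasure, integral_prod _ (integrable_rieszKernel_mul hα hab hmx hx)]
    simp only [hr, hR, swapCoord, leftKernel, rightKernel, Function.update_self,
      Function.update_idem, rieszKernel, axisMeasure, add_mul]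
  refine ⟨hr2.integral_prod_left.congr hslice, ?_⟩
  have he : MeasurableEmbedding (swapCoord i) :=
    MeasurableEquiv.measurableEmbedding
      (⟨⟨swapCoord i, swapCoord i, swapCoord_swapCoord i, swapCoord_swapCoord i⟩,
        measurable_swapCoord i, measurable_swapCoord i⟩ : _ ≃ᵐ _)
  rw [← integral_congr_ae hslice, ← integral_prod _ hr2,
    (measurePreserving_swapCoord a b i).integral_comp he (fun z => r z.1), integral_fun_fst,
    hr, ← integral_prod _ hRi, hRint, measureReal_def, axisMeasure_univ,
    ENNReal.toReal_ofReal (sub_nonneg.2 hab.le), smul_eq_mul]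
  ring

theorem sliceEnergy_nonneg_ae (hα0 : 0 < α) (hα1 : α < 1) (hab : a i < b i) (hm : Measurable v)
    (hv : MemLp v 2 (boxMeasure a b)) :
    0 ≤ᵐ[boxMeasure a b] sliceEnergy a b α i v := by
  filter_upwards [ae_memLp_slice (i := i) hm hv] with x hx
  exact energy_nonneg hα0 hα1 hab
    (hm.comp ((measurable_updateCoord i).comp measurable_prodMk_left)) hx

theorem integral_leftKernel_nonneg (hα0 : 0 < α) (hα1 : α < 1) (hab : a i < b i)
    (hm : Measurable v) (hv : MemLp v 2 (boxMeasure a b)) :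
    0 ≤ ∫ z, leftKernel α i z * (v z.1 * v (swapCoord i z).1)
        ∂((boxMeasure a b).prod (axisMeasure a b i)) := by
  have h := integral_nonneg_of_ae (sliceEnergy_nonneg_ae hα0 hα1 hab hm hv)
  rw [(integral_sliceEnergy hα0 hab hm hv).2] at h
  exact nonneg_of_mul_nonneg_right h (mul_pos two_pos (sub_pos.2 hab))

theorem ae_eq_zero_of_integral_leftKernel (hα0 : 0 < α) (hα1 : α < 1) (hab : a i < b i)
    (hm : Measurable v) (hv : MemLp v 2 (boxMeasure a b))
    (h : ∫ z, leftKernel α i z * (v z.1 * v (swapCoord i z).1)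
        ∂((boxMeasure a b).prod (axisMeasure a b i)) = 0) :
    v =ᵐ[boxMeasure a b] 0 := by
  obtain ⟨hI, h1⟩ := integral_sliceEnergy hα0 hab hm hv
  rw [h, mul_zero, integral_eq_zero_iff_of_nonneg_ae
    (sliceEnergy_nonneg_ae hα0 hα1 hab hm hv) hI] at h1
  refine ae_of_ae_ae_update hab (hm (measurableSet_singleton 0)) ?_
  filter_upwards [h1, ae_memLp_slice (i := i) hm hv] with x hx hx'
  exact ae_eq_zero_of_energy_eq_zero hα0 hα1 hab
    (hm.comp ((measurable_updateCoord i).comp measurable_prodMk_left)) hx' hx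

/-- If the energies `∫ (pᵢ J^α_{left} + qᵢ J^α_{right}) Dᵢ · Dᵢ` add up to zero, then all the
functions `Dᵢ` vanish. -/
theorem ae_eq_zero_of_sum_energy (hα0 : 0 < α) (hα1 : α < 1) (hab : ∀ i, a i < b i)
    {p q : Fin n → ℝ} (hp : ∀ i, 0 < p i) (hq : ∀ i, 0 < q i)
    {D : Fin n → (Fin n → ℝ) → ℝ} (hD : ∀ i, MemLp (D i) 2 (boxMeasure a b))
    (h : ∑ i, ∫ x, (p i * leftInt a α i (D i) x + q i * rightInt b α i (D i) x) * D i x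
      ∂boxMeasure a b = 0) (i : Fin n) : D i =ᵐ[boxMeasure a b] 0 := by
  choose D' hD'm hDD' using fun i => (hD i).1
  have hD' : ∀ i, MemLp (D' i) 2 (boxMeasure a b) := fun i => (memLp_congr_ae (hDD' i)).1 (hD i)
  have hm : ∀ i, Measurable (D' i) := fun i => (hD'm i).measurable
  -- Measurable representatives `D'` are used, since the slicing lemmas need honest measurability;
  -- the left and right forms then merge with weight `pᵢ + qᵢ`.
  have hterm : ∀ i, ∫ x, (p i * leftInt a α i (D i) x + q i * rightInt b α i (D i) x) * D i x
      ∂boxMeasure a b = (p i + q i) * (1 / Real.Gamma α) *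
        ∫ z, leftKernel α i z * (D' i z.1 * D' i (swapCoord i z).1)
          ∂((boxMeasure a b).prod (axisMeasure a b i)) := by
    intro i
    have hL : Integrable (fun x => leftInt a α i (D' i) x * D' i x) (boxMeasure a b) :=
      (memLp_leftInt hα0 (hab i) (hD' i)).integrable_mul (hD' i)
    have hR : Integrable (fun x => rightInt b α i (D' i) x * D' i x) (boxMeasure a b) :=
      (memLp_rightInt hα0 (hab i) (hD' i)).integrable_mul (hD' i)
    have e1 : (fun x => (p i * leftInt a α i (D i) x + q i * rightInt b α i (D i) x) * D i x)
        =ᵐ[boxMeasure a b] fun x => p i * (leftInt a α i (D' i) x * D' i x)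
          + q i * (rightInt b α i (D' i) x * D' i x) := by
      filter_upwards [hDD' i, leftInt_congr_ae (i := i) hα0.ne' (hDD' i),
        rightInt_congr_ae (i := i) hα0.ne' (hDD' i)] with x h1 h2 h3
      rw [h1, h2, h3]; ring
    rw [integral_congr_ae e1, integral_add (hL.const_mul _) (hR.const_mul _),
      integral_const_mul, integral_const_mul, integral_leftInt_mul hα0 (hab i) (hm i) (hD' i),
      integral_rightInt_mul hα0 (hab i) (hm i) (hD' i), ← integral_leftKernel_eq_rightKernel]
    ring
  simp only [hterm] at h
  have hΓ : 0 < 1 / Real.Gamma α := one_div_pos.2 (Real.Gamma_pos_of_pos hα0)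
  have hpos : ∀ i, 0 < (p i + q i) * (1 / Real.Gamma α) :=
    fun i => mul_pos (add_pos (hp i) (hq i)) hΓ
  have h0 := (Finset.sum_eq_zero_iff_of_nonneg fun j _ => mul_nonneg (hpos j).le
    (integral_leftKernel_nonneg hα0 hα1 (hab j) (hm j) (hD' j))).1 h i (Finset.mem_univ i)
  exact (hDD' i).trans (ae_eq_zero_of_integral_leftKernel hα0 hα1 (hab i) (hm i) (hD' i)
    ((mul_eq_zero.1 h0).resolve_left (hpos i).ne'))

end FractionalIntegrals

/-! ### Functions with vanishing trace near the boundary -/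

section Norms

variable {X : Type*} [MeasurableSpace X] {μ : Measure X}

theorem enorm_sq_eq_ofReal (x : ℝ) : ‖x‖ₑ ^ 2 = ENNReal.ofReal (x ^ 2) := by
  rw [Real.enorm_eq_ofReal_abs, ← ENNReal.ofReal_pow (abs_nonneg x), sq_abs]

theorem eLpNorm_two_sq (f : X → ℝ) (μ : Measure X) :
    eLpNorm f 2 μ ^ 2 = ∫⁻ x, ‖f x‖ₑ ^ 2 ∂μ := by
  have := eLpNorm_nnreal_pow_eq_lintegral (f := f) (μ := μ) (p := 2) two_ne_zero
  simpa using this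

theorem tendsto_eLpNorm_two {ι : Type*} {l : Filter ι} {f : ι → X → ℝ} {g : X → ℝ}
    (hf : ∀ k, AEStronglyMeasurable (f k) μ) (hg : MemLp g 2 μ)
    (h : Tendsto (fun k => eLpNorm (fun x => f k x - g x) 2 μ) l (𝓝 0)) :
    Tendsto (fun k => eLpNorm (f k) 2 μ) l (𝓝 (eLpNorm g 2 μ)) := by
  have h1 : Tendsto (fun k => eLpNorm g 2 μ - eLpNorm (fun x => f k x - g x) 2 μ) l
      (𝓝 (eLpNorm g 2 μ)) := by
    simpa using ENNReal.Tendsto.sub (tendsto_const_nhds (x := eLpNorm g 2 μ)) h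
      (Or.inr ENNReal.zero_ne_top)
  have h2 : Tendsto (fun k => eLpNorm g 2 μ + eLpNorm (fun x => f k x - g x) 2 μ) l
      (𝓝 (eLpNorm g 2 μ)) := by
    simpa using (tendsto_const_nhds (x := eLpNorm g 2 μ)).add h
  refine tendsto_of_tendsto_of_tendsto_of_le_of_le h1 h2 (fun k => ?_) (fun k => ?_)
  · refine tsub_le_iff_right.2 ?_
    have := eLpNorm_sub_le (hf k) ((hf k).sub hg.1) (p := 2) one_le_two
    rwa [sub_sub_cancel] at this
  · have := eLpNorm_add_le hg.1 ((hf k).sub hg.1) (p := 2) one_le_two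
    rwa [add_sub_cancel] at this

theorem lintegral_enorm_mul_le {f g : X → ℝ} (hf : AEStronglyMeasurable f μ)
    (hg : AEStronglyMeasurable g μ) :
    ∫⁻ x, ‖f x‖ₑ * ‖g x‖ₑ ∂μ ≤ eLpNorm f 2 μ * eLpNorm g 2 μ := by
  have := eLpNorm_smul_le_mul_eLpNorm (p := 2) (q := 2) (r := 1) hg hf
  rw [eLpNorm_one_eq_lintegral_enorm] at this
  simpa [enorm_mul] using this

theorem tendsto_integral_mul_of_eLpNorm_two {ι : Type*} {l : Filter ι} {f : ι → X → ℝ}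
    {g G : X → ℝ} (hG : MemLp G 2 μ) (hf : ∀ k, MemLp (f k) 2 μ) (hg : MemLp g 2 μ)
    (h : Tendsto (fun k => eLpNorm (fun x => f k x - g x) 2 μ) l (𝓝 0)) :
    Tendsto (fun k => ∫ x, G x * f k x ∂μ) l (𝓝 (∫ x, G x * g x ∂μ)) := by
  refine tendsto_integral_of_L1 _ (hG.integrable_mul hg).1
    (Eventually.of_forall fun k => hG.integrable_mul (hf k)) ?_
  have h1 : Tendsto (fun k => eLpNorm G 2 μ * eLpNorm (fun x => f k x - g x) 2 μ) l (𝓝 0) := by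
    simpa using ENNReal.Tendsto.const_mul h (Or.inr hG.2.ne)
  refine tendsto_of_tendsto_of_tendsto_of_le_of_le tendsto_const_nhds h1
    (fun k => zero_le) (fun k => ?_)
  refine le_trans (le_of_eq (lintegral_congr fun x => ?_))
    (lintegral_enorm_mul_le hG.1 ((hf k).sub hg).1)
  rw [Pi.mul_apply, ← mul_sub, enorm_mul]

/-- Dominated convergence for `‖f‖²` times the indicator of `s k`. It is applied to strips shrinking
to a face. -/
theorem tendsto_eLpNorm_two_restrict_zero {ι : Type*} {l : Filter ι} [l.IsCountablyGenerated]
    {f : X → ℝ} (hf : MemLp f 2 μ) {s : ι → Set X} (hs : ∀ k, MeasurableSet (s k))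
    (h : ∀ᵐ x ∂μ, ∀ᶠ k in l, x ∉ s k) :
    Tendsto (fun k => eLpNorm f 2 (μ.restrict (s k))) l (𝓝 0) := by
  have h1 : Tendsto (fun k => eLpNorm f 2 (μ.restrict (s k)) ^ 2) l (𝓝 0) := by
    simp only [eLpNorm_two_sq, ← lintegral_indicator (hs _)]
    rw [← lintegral_zero (μ := μ)]
    have hfin : ∫⁻ x, ‖f x‖ₑ ^ 2 ∂μ ≠ ⊤ := by
      rw [← eLpNorm_two_sq]; exact ENNReal.pow_ne_top hf.2.ne
    refine tendsto_lintegral_filter_of_dominated_convergence' (fun x => ‖f x‖ₑ ^ 2)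
      (Eventually.of_forall fun k => ((hf.1.enorm.pow_const 2).indicator (hs k)))
      (Eventually.of_forall fun k => Eventually.of_forall fun x =>
        Set.indicator_le_self' (fun _ _ => zero_le) x) hfin ?_
    filter_upwards [h] with x hx
    refine tendsto_const_nhds.congr' ?_
    filter_upwards [hx] with k hk
    rw [Set.indicator_of_notMem hk]
  have h2 := h1.ennrpow_const (1 / 2 : ℝ)
  simp only [← ENNReal.rpow_natCast, ← ENNReal.rpow_mul] at h2
  simpa using h2

end Norms

/-! ### Strip estimates at the faces -/

section Strip

/-- The fundamental theorem of calculus from `e` to `t`, with Cauchy–Schwarz on the increment. The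
point `e` will be the end of the line on the face. -/
theorem contDiff_sq_le {g : ℝ → ℝ} (hg : ContDiff ℝ 1 g) {l r e t : ℝ}
    (he : e ∈ Set.Icc l r) (ht : t ∈ Set.Icc l r) :
    g t ^ 2 ≤ 2 * g e ^ 2 + 2 * ((r - l) * ∫ s in Set.Ioo l r, deriv g s ^ 2) := by
  have hc : Continuous (deriv g) := hg.continuous_deriv le_rfl
  have h1 : ∫ s in e..t, deriv g s = g t - g e :=
    intervalIntegral.integral_deriv_eq_sub
      (fun x _ => (hg.differentiable one_ne_zero).differentiableAt) (hc.intervalIntegrable _ _)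
  have hio : ∀ x y : ℝ, ∀ f : ℝ → ℝ, Continuous f → IntegrableOn f (Set.uIoc x y) :=
    fun x y f hf => (intervalIntegrable_iff.1 (hf.intervalIntegrable x y))
  have h2 : (∫ s in e..t, deriv g s) ^ 2 ≤ (r - l) * ∫ s in Set.Ioo l r, deriv g s ^ 2 := by
    rw [← sq_abs, intervalIntegral.abs_integral_eq_abs_integral_uIoc, sq_abs]
    have h3 := sq_integral_mul_le (ν := volume.restrict (Set.uIoc e t)) (k := fun _ => 1)
      (f := deriv g) (fun _ => zero_le_one) (hio _ _ _ continuous_const)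
      (by simp only [one_mul]; exact hio _ _ _ hc)
      (by simp only [one_mul]; exact hio _ _ _ (hc.pow 2))
    simp only [one_mul, integral_const, smul_eq_mul, mul_one, measureReal_restrict_apply_univ,
      Set.uIoc, Real.volume_real_Ioc_of_le min_le_max] at h3
    refine h3.trans (mul_le_mul ?_ ?_ (integral_nonneg fun _ => sq_nonneg _) ?_)
    · linarith [le_min he.1 ht.1, max_le he.2 ht.2]
    · rw [← integral_Ioc_eq_integral_Ioo]
      have hlr : l ≤ r := he.1.trans he.2
      refine setIntegral_mono_set ?_ (Eventually.of_forall fun _ => sq_nonneg _) ?_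
      · rw [← Set.uIoc_of_le hlr]; exact hio l r _ (hc.pow 2)
      · refine LE.le.eventuallyLE ?_
        exact Set.Ioc_subset_Ioc (le_min he.1 ht.1) (max_le he.2 ht.2)
    · linarith [he.1, he.2]
  rw [h1] at h2
  -- `2 (g e)² + 2 (g t - g e)² - (g t)² = (g t - 2 g e)²`.
  nlinarith [sq_nonneg (g t - 2 * g e)]

theorem lintegral_contDiff_sq_le {g : ℝ → ℝ} (hg : ContDiff ℝ 1 g) {l r e : ℝ}
    (he : e ∈ Set.Icc l r) :
    ∫⁻ t in Set.Ioo l r, ‖g t‖ₑ ^ 2 ≤ ENNReal.ofReal (2 * (r - l)) * ‖g e‖ₑ ^ 2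
      + ENNReal.ofReal (2 * (r - l) ^ 2) * ∫⁻ t in Set.Ioo l r, ‖deriv g t‖ₑ ^ 2 := by
  have hlr : 0 ≤ r - l := by linarith [he.1, he.2]
  have hc : Continuous (deriv g) := hg.continuous_deriv le_rfl
  have hi : IntegrableOn (fun s => deriv g s ^ 2) (Set.Ioo l r) :=
    ((hc.pow 2).integrableOn_Icc).mono_set Set.Ioo_subset_Icc_self
  have h1 : ∫⁻ t in Set.Ioo l r, ‖deriv g t‖ₑ ^ 2
      = ENNReal.ofReal (∫ s in Set.Ioo l r, deriv g s ^ 2) := by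
    rw [ofReal_integral_eq_lintegral_ofReal hi (Eventually.of_forall fun _ => sq_nonneg _)]
    simp only [enorm_sq_eq_ofReal]
  have hI : 0 ≤ ∫ s in Set.Ioo l r, deriv g s ^ 2 := integral_nonneg fun _ => sq_nonneg _
  rw [h1, enorm_sq_eq_ofReal, ← ENNReal.ofReal_mul (by positivity),
    ← ENNReal.ofReal_mul (by positivity), ← ENNReal.ofReal_add (by positivity) (by positivity)]
  calc ∫⁻ t in Set.Ioo l r, ‖g t‖ₑ ^ 2
      ≤ ∫⁻ _ in Set.Ioo l r, ENNReal.ofReal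
        (2 * g e ^ 2 + 2 * ((r - l) * ∫ s in Set.Ioo l r, deriv g s ^ 2)) := by
        refine setLIntegral_mono measurable_const fun t ht => ?_
        rw [enorm_sq_eq_ofReal]
        exact ENNReal.ofReal_le_ofReal (contDiff_sq_le hg he (Set.Ioo_subset_Icc_self ht))
    _ = _ := by
        rw [lintegral_const, Measure.restrict_apply_univ, Real.volume_Ioo,
          ← ENNReal.ofReal_mul (by positivity)]
        congr 1
        ring

variable {n : ℕ} {a b : Fin n → ℝ} {i : Fin n}

theorem hasDerivAt_comp_update {φ : (Fin n → ℝ) → ℝ} (hφ : Differentiable ℝ φ) (i : Fin n)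
    (x : Fin n → ℝ) (t : ℝ) :
    HasDerivAt (fun w => φ (Function.update x i w)) (partialD i φ (Function.update x i t)) t :=
  (hφ (Function.update x i t)).hasFDerivAt.comp_hasDerivAt t (hasDerivAt_update x i t)

theorem continuous_partialD {φ : (Fin n → ℝ) → ℝ} (hφ : ContDiff ℝ 1 φ) (i : Fin n) :
    Continuous (partialD i φ) :=
  (hφ.continuous_fderiv one_ne_zero).clm_apply continuous_const

/-- The slab `l < xᵢ < r`. -/
def slab (i : Fin n) (l r : ℝ) : Set (Fin n → ℝ) := {x | x i ∈ Set.Ioo l r}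

theorem measurableSet_slab (i : Fin n) (l r : ℝ) : MeasurableSet (slab i l r) :=
  measurable_pi_apply i measurableSet_Ioo

theorem lintegral_slab {l r : ℝ} (hl : a i ≤ l) (hr : r ≤ b i) {f : (Fin n → ℝ) → ENNReal}
    (hf : Measurable f) :
    ENNReal.ofReal (b i - a i) * ∫⁻ x in slab i l r, f x ∂boxMeasure a b
      = ∫⁻ x, (∫⁻ w in Set.Ioo l r, f (Function.update x i w)) ∂boxMeasure a b := by
  rw [← lintegral_indicator (measurableSet_slab i l r),
    ← lintegral_prod_update a b i (hf.indicator (measurableSet_slab i l r))]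
  refine lintegral_congr fun x => ?_
  have : (fun w => (slab i l r).indicator f (Function.update x i w))
      = (Set.Ioo l r).indicator fun w => f (Function.update x i w) := by
    ext w
    simp [Set.indicator, slab]
  rw [this, axisMeasure, lintegral_indicator measurableSet_Ioo,
    Measure.restrict_restrict measurableSet_Ioo,
    Set.inter_eq_left.2 (Set.Ioo_subset_Ioo hl hr)]

theorem lintegral_faceMeasure (a b : Fin n → ℝ) (i : Fin n) (c : ℝ)
    {f : (Fin n → ℝ) → ENNReal} (hf : Measurable f) :
    ∫⁻ x, f x ∂faceMeasure a b i c
      = (ENNReal.ofReal (b i - a i))⁻¹ * ∫⁻ x, f (Function.update x i c) ∂boxMeasure a b := by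
  rw [faceMeasure, lintegral_smul_measure, lintegral_map hf]
  · rfl
  · exact (measurable_updateCoord i).comp (measurable_id.prodMk measurable_const)

/-- The one-dimensional estimate integrated over all lines in the `i`-th direction. Multiplying by
`bᵢ - aᵢ` turns the slab integrals into iterated ones and cancels the normalisation of
`faceMeasure`. -/
theorem slab_inequality (hab : a i < b i) {l r e : ℝ} (hl : a i ≤ l) (hr : r ≤ b i)
    (he : e ∈ Set.Icc l r) {φ : (Fin n → ℝ) → ℝ} (hφ : ContDiff ℝ 1 φ) :
    eLpNorm φ 2 ((boxMeasure a b).restrict (slab i l r)) ^ 2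
      ≤ ENNReal.ofReal (2 * (r - l)) * eLpNorm φ 2 (faceMeasure a b i e) ^ 2
        + ENNReal.ofReal (2 * (r - l) ^ 2) *
          eLpNorm (partialD i φ) 2 ((boxMeasure a b).restrict (slab i l r)) ^ 2 := by
  have hm : Measurable fun x => ‖φ x‖ₑ ^ 2 := hφ.continuous.measurable.enorm.pow_const 2
  have hm' : Measurable fun x => ‖partialD i φ x‖ₑ ^ 2 :=
    (continuous_partialD hφ i).measurable.enorm.pow_const 2
  have hL0 : ENNReal.ofReal (b i - a i) ≠ 0 := by simpa using hab
  rw [eLpNorm_two_sq, eLpNorm_two_sq, eLpNorm_two_sq, lintegral_faceMeasure a b i e hm]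
  refine (ENNReal.mul_le_mul_iff_right hL0 ENNReal.ofReal_ne_top).1 ?_
  rw [lintegral_slab hl hr hm, mul_add, mul_left_comm, ← mul_assoc (ENNReal.ofReal (b i - a i)),
    ENNReal.mul_inv_cancel hL0 ENNReal.ofReal_ne_top, one_mul,
    mul_left_comm (ENNReal.ofReal (b i - a i)), lintegral_slab hl hr hm',
    ← lintegral_const_mul' _ _ ENNReal.ofReal_ne_top,
    ← lintegral_const_mul' _ _ ENNReal.ofReal_ne_top, ← lintegral_add_left]
  · refine lintegral_mono fun x => ?_
    have hd : deriv (fun w => φ (Function.update x i w))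
        = fun w => partialD i φ (Function.update x i w) :=
      funext fun t => (hasDerivAt_comp_update (hφ.differentiable one_ne_zero) i x t).deriv
    have hg : ContDiff ℝ 1 fun w => φ (Function.update x i w) :=
      hφ.comp (contDiff_update 1 x i)
    have := lintegral_contDiff_sq_le hg he
    rwa [hd] at this
  · exact (hm.comp ((measurable_updateCoord i).comp
      (measurable_id.prodMk measurable_const))).const_mul _

/-- `φ` is a sequence of smooth functions which approximates `u` and its gradient `D` in `L²(Ω)`,
with boundary values that tend to zero in `L²(∂Ω)`. -/
structure IsZeroTraceApprox (a b : Fin n → ℝ) (u : (Fin n → ℝ) → ℝ)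
    (D : Fin n → (Fin n → ℝ) → ℝ) (φ : ℕ → (Fin n → ℝ) → ℝ) : Prop where
  smooth : ∀ k, ContDiff ℝ ∞ (φ k)
  memLp : MemLp u 2 (boxMeasure a b)
  memLp_grad : ∀ i, MemLp (D i) 2 (boxMeasure a b)
  tendsto : Tendsto (fun k => eLpNorm (fun x => φ k x - u x) 2 (boxMeasure a b)) atTop (𝓝 0)
  tendsto_grad : ∀ i, Tendsto
    (fun k => eLpNorm (fun x => partialD i (φ k) x - D i x) 2 (boxMeasure a b)) atTop (𝓝 0)
  tendsto_boundary :
    Tendsto (fun k => eLpNorm (φ k) 2 (boundaryMeasure a b)) atTop (𝓝 0)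

theorem faceMeasure_left_le (a b : Fin n → ℝ) (i : Fin n) :
    faceMeasure a b i (a i) ≤ boundaryMeasure a b := by
  refine le_trans ?_ (Finset.single_le_sum (f := fun i => faceMeasure a b i (a i)
    + faceMeasure a b i (b i)) (fun _ _ => Measure.zero_le _) (Finset.mem_univ i))
  exact le_add_of_nonneg_right (Measure.zero_le _)

theorem faceMeasure_right_le (a b : Fin n → ℝ) (i : Fin n) :
    faceMeasure a b i (b i) ≤ boundaryMeasure a b := by
  refine le_trans ?_ (Finset.single_le_sum (f := fun i => faceMeasure a b i (a i)
    + faceMeasure a b i (b i)) (fun _ _ => Measure.zero_le _) (Finset.mem_univ i))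
  exact le_add_of_nonneg_left (Measure.zero_le _)

variable {u : (Fin n → ℝ) → ℝ} {D : Fin n → (Fin n → ℝ) → ℝ} {φ : ℕ → (Fin n → ℝ) → ℝ}

/-- In the limit of `slab_inequality` along the approximating sequence the face term disappears,
leaving a bound linear in the width of the slab. That linear rate later compensates the gradient of
the cut-off. -/
theorem IsZeroTraceApprox.slab_le (h : IsZeroTraceApprox a b u D φ) (hab : a i < b i)
    {l r e : ℝ} (hl : a i ≤ l) (hr : r ≤ b i) (he : e ∈ Set.Icc l r) (he' : e = a i ∨ e = b i) :
    eLpNorm u 2 ((boxMeasure a b).restrict (slab i l r))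
      ≤ ENNReal.ofReal (2 * (r - l)) *
        eLpNorm (D i) 2 ((boxMeasure a b).restrict (slab i l r)) := by
  have hlr : 0 ≤ r - l := by linarith [he.1, he.2]
  set μ := (boxMeasure a b).restrict (slab i l r) with hμ
  have hle : μ ≤ boxMeasure a b := Measure.restrict_le_self
  have hface : faceMeasure a b i e ≤ boundaryMeasure a b := by
    rcases he' with rfl | rfl
    exacts [faceMeasure_left_le a b i, faceMeasure_right_le a b i]
  have hφ : ∀ k, ContDiff ℝ 1 (φ k) := fun k =>
    (h.smooth k).of_le (by exact_mod_cast le_top)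
  have t1 : Tendsto (fun k => eLpNorm (φ k) 2 μ) atTop (𝓝 (eLpNorm u 2 μ)) :=
    tendsto_eLpNorm_two (fun k => (hφ k).continuous.aestronglyMeasurable)
      (h.memLp.mono_measure hle)
      (tendsto_of_tendsto_of_tendsto_of_le_of_le tendsto_const_nhds h.tendsto
        (fun _ => zero_le) (fun k => eLpNorm_mono_measure _ hle))
  have t2 : Tendsto (fun k => eLpNorm (partialD i (φ k)) 2 μ) atTop (𝓝 (eLpNorm (D i) 2 μ)) :=
    tendsto_eLpNorm_two (fun k => (continuous_partialD (hφ k) i).aestronglyMeasurable)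
      ((h.memLp_grad i).mono_measure hle)
      (tendsto_of_tendsto_of_tendsto_of_le_of_le tendsto_const_nhds (h.tendsto_grad i)
        (fun _ => zero_le) (fun k => eLpNorm_mono_measure _ hle))
  have t3 : Tendsto (fun k => eLpNorm (φ k) 2 (faceMeasure a b i e)) atTop (𝓝 0) :=
    tendsto_of_tendsto_of_tendsto_of_le_of_le tendsto_const_nhds h.tendsto_boundary
      (fun _ => zero_le) (fun k => eLpNorm_mono_measure _ hface)
  have t4 := (ENNReal.Tendsto.const_mul (a := ENNReal.ofReal (2 * (r - l)))
    (ENNReal.Tendsto.pow (n := 2) t3) (Or.inr ENNReal.ofReal_ne_top)).add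
    (ENNReal.Tendsto.const_mul (a := ENNReal.ofReal (2 * (r - l) ^ 2))
    (ENNReal.Tendsto.pow (n := 2) t2) (Or.inr ENNReal.ofReal_ne_top))
  have key := le_of_tendsto_of_tendsto' (ENNReal.Tendsto.pow (n := 2) t1) t4
    fun k => slab_inequality hab hl hr he (hφ k)
  rw [← ENNReal.pow_le_pow_left_iff two_ne_zero, mul_pow, ← ENNReal.ofReal_pow (by positivity)]
  refine key.trans ?_
  rw [zero_pow two_ne_zero, mul_zero, zero_add]
  gcongr
  -- The sharper constant `2 (r - l)²` is weakened to `(2 (r - l))²` so as to be a square.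
  nlinarith [sq_nonneg (r - l)]

/-- Poincaré's inequality, as the strip estimate for the slab that fills the box; one direction
suffices. -/
theorem IsZeroTraceApprox.ae_eq_zero (h : IsZeroTraceApprox a b u D φ) (hab : a i < b i)
    (hD : D i =ᵐ[boxMeasure a b] 0) : u =ᵐ[boxMeasure a b] 0 := by
  have h1 := h.slab_le hab le_rfl le_rfl (Set.left_mem_Icc.2 hab.le) (Or.inl rfl)
  have h2 : (boxMeasure a b).restrict (slab i (a i) (b i)) = boxMeasure a b := by
    refine Measure.restrict_eq_self_of_ae_mem ?_
    filter_upwards [ae_mem_box a b] with x hx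
    exact hx i (Set.mem_univ i)
  rw [h2, eLpNorm_congr_ae hD, eLpNorm_zero, mul_zero, nonpos_iff_eq_zero,
    eLpNorm_eq_zero_iff h.memLp.1 two_ne_zero] at h1
  exact h1

end Strip

/-! ### Cut-off functions -/

section Cutoff

theorem exists_bound_deriv_smoothTransition :
    ∃ C, 0 ≤ C ∧ ∀ t, |deriv Real.smoothTransition t| ≤ C := by
  have hc : Continuous (deriv Real.smoothTransition) :=
    (Real.smoothTransition.contDiff (n := 1)).continuous_deriv le_rfl
  obtain ⟨C, hC⟩ := (isCompact_Icc (a := (0 : ℝ)) (b := 1)).exists_bound_of_continuousOn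
    hc.continuousOn
  have hC0 : 0 ≤ C := (norm_nonneg _).trans (hC 0 (by simp))
  refine ⟨C, hC0, fun t => ?_⟩
  rcases lt_or_ge t 0 with h0 | h0
  · have : Real.smoothTransition =ᶠ[𝓝 t] fun _ => 0 := by
      filter_upwards [Iio_mem_nhds h0] with s hs
      exact Real.smoothTransition.zero_of_nonpos (le_of_lt hs)
    rw [this.deriv_eq, deriv_const, abs_zero]
    exact hC0
  · rcases le_or_gt t 1 with h1 | h1
    · exact hC t ⟨h0, h1⟩
    · have : Real.smoothTransition =ᶠ[𝓝 t] fun _ => 1 := by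
        filter_upwards [Ioi_mem_nhds h1] with s hs
        exact Real.smoothTransition.one_of_one_le (le_of_lt hs)
      rw [this.deriv_eq, deriv_const, abs_zero]
      exact hC0

/-- A smooth cut-off function on `(l, r)` at distance `δ` from the end points. -/
noncomputable def intervalCutoff (l r δ t : ℝ) : ℝ :=
  Real.smoothTransition ((t - l) / δ - 1) * Real.smoothTransition ((r - t) / δ - 1)

variable {l r δ t : ℝ}

theorem contDiff_intervalCutoff (l r δ : ℝ) : ContDiff ℝ ∞ (intervalCutoff l r δ) :=
  (Real.smoothTransition.contDiff.comp
    (((contDiff_id.sub contDiff_const).div_const _).sub contDiff_const)).mul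
  (Real.smoothTransition.contDiff.comp
    (((contDiff_const.sub contDiff_id).div_const _).sub contDiff_const))

theorem intervalCutoff_nonneg (l r δ t : ℝ) : 0 ≤ intervalCutoff l r δ t :=
  mul_nonneg (Real.smoothTransition.nonneg _) (Real.smoothTransition.nonneg _)

theorem intervalCutoff_le_one (l r δ t : ℝ) : intervalCutoff l r δ t ≤ 1 :=
  mul_le_one₀ (Real.smoothTransition.le_one _) (Real.smoothTransition.nonneg _)
    (Real.smoothTransition.le_one _)

theorem mem_Icc_of_intervalCutoff_ne_zero (hδ : 0 < δ) (h : intervalCutoff l r δ t ≠ 0) :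
    t ∈ Set.Icc (l + δ) (r - δ) := by
  have h1 := left_ne_zero_of_mul h
  have h2 := right_ne_zero_of_mul h
  rw [Ne, Real.smoothTransition.zero_iff_nonpos, not_le, sub_pos, one_lt_div hδ] at h1 h2
  constructor <;> linarith

theorem intervalCutoff_eq_one (hδ : 0 < δ) (h : t ∈ Set.Icc (l + 2 * δ) (r - 2 * δ)) :
    intervalCutoff l r δ t = 1 := by
  rw [intervalCutoff, Real.smoothTransition.one_of_one_le, Real.smoothTransition.one_of_one_le,
    one_mul]
  · rw [le_sub_iff_add_le, le_div_iff₀ hδ]; linarith [h.2]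
  · rw [le_sub_iff_add_le, le_div_iff₀ hδ]; linarith [h.1]

theorem deriv_intervalCutoff_eq_zero (hδ : 0 < δ)
    (h : t ∈ Set.Ioo (l + 2 * δ) (r - 2 * δ)) : deriv (intervalCutoff l r δ) t = 0 := by
  have : intervalCutoff l r δ =ᶠ[𝓝 t] fun _ => 1 := by
    filter_upwards [Ioo_mem_nhds h.1 h.2] with s hs
    exact intervalCutoff_eq_one hδ (Set.Ioo_subset_Icc_self hs)
  rw [this.deriv_eq, deriv_const]

theorem abs_deriv_intervalCutoff_le {C : ℝ} (hC : ∀ t, |deriv Real.smoothTransition t| ≤ C)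
    (hδ : 0 < δ) (l r t : ℝ) : |deriv (intervalCutoff l r δ) t| ≤ 2 * C / δ := by
  have hd : ∀ s, HasDerivAt Real.smoothTransition (deriv Real.smoothTransition s) s := fun s =>
    ((Real.smoothTransition.contDiff (n := 1)).differentiable one_ne_zero s).hasDerivAt
  have h1 : HasDerivAt (fun t => (t - l) / δ - 1) (1 / δ) t :=
    (((hasDerivAt_id t).sub_const l).div_const δ).sub_const 1
  have h2 : HasDerivAt (fun t => (r - t) / δ - 1) (-1 / δ) t :=
    (((hasDerivAt_id t).const_sub r).div_const δ).sub_const 1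
  have h3 : HasDerivAt (intervalCutoff l r δ) _ t := ((hd _).comp t h1).mul ((hd _).comp t h2)
  rw [h3.deriv]
  have bound : ∀ x y e : ℝ, |e| = 1 / δ → 0 ≤ y → y ≤ 1 →
      |deriv Real.smoothTransition x * e * y| ≤ C / δ := by
    intro x y e he hy0 hy1
    rw [abs_mul, abs_mul, he, abs_of_nonneg hy0, mul_one_div]
    refine (mul_le_of_le_one_right (by positivity) hy1).trans ?_
    gcongr
    exact hC x
  have e1 : |1 / δ| = 1 / δ := abs_of_pos (by positivity)
  have e2 : |-1 / δ| = 1 / δ := by rw [neg_div, abs_neg, e1]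
  refine (abs_add_le _ _).trans ?_
  rw [two_mul, add_div]
  refine add_le_add ?_ ?_
  · exact bound _ _ _ e1 (Real.smoothTransition.nonneg _) (Real.smoothTransition.le_one _)
  · rw [mul_comm]
    exact bound _ _ _ e2 (Real.smoothTransition.nonneg _) (Real.smoothTransition.le_one _)

variable {n : ℕ} {a b : Fin n → ℝ} {i : Fin n} {x : Fin n → ℝ}

/-- A smooth cut-off function on the box, at distance `δ` from the boundary. -/
noncomputable def boxCutoff (a b : Fin n → ℝ) (δ : ℝ) (x : Fin n → ℝ) : ℝ :=
  ∏ j, intervalCutoff (a j) (b j) δ (x j)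

theorem contDiff_boxCutoff (a b : Fin n → ℝ) (δ : ℝ) : ContDiff ℝ ∞ (boxCutoff a b δ) :=
  contDiff_prod fun j _ => (contDiff_intervalCutoff _ _ _).comp (contDiff_apply ℝ ℝ j)

theorem boxCutoff_nonneg (a b : Fin n → ℝ) (δ : ℝ) (x : Fin n → ℝ) : 0 ≤ boxCutoff a b δ x :=
  Finset.prod_nonneg fun _ _ => intervalCutoff_nonneg _ _ _ _

theorem boxCutoff_le_one (a b : Fin n → ℝ) (δ : ℝ) (x : Fin n → ℝ) : boxCutoff a b δ x ≤ 1 :=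
  Finset.prod_le_one (fun _ _ => intervalCutoff_nonneg _ _ _ _)
    fun _ _ => intervalCutoff_le_one _ _ _ _

theorem tsupport_boxCutoff_subset (hδ : 0 < δ) :
    tsupport (boxCutoff a b δ) ⊆ Set.Icc (fun j => a j + δ) (fun j => b j - δ) := by
  refine closure_minimal (fun x hx => ?_) isClosed_Icc
  have h := fun j => mem_Icc_of_intervalCutoff_ne_zero hδ
    (Finset.prod_ne_zero_iff.1 hx j (Finset.mem_univ j))
  exact ⟨fun j => (h j).1, fun j => (h j).2⟩

theorem isTestFunction_boxCutoff_mul (hδ : 0 < δ) {φ : (Fin n → ℝ) → ℝ} (hφ : ContDiff ℝ ∞ φ) :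
    IsTestFunction (box a b) fun x => boxCutoff a b δ x * φ x := by
  have h1 : tsupport (fun x => boxCutoff a b δ x * φ x)
      ⊆ Set.Icc (fun j => a j + δ) (fun j => b j - δ) :=
    (tsupport_mul_subset_left).trans (tsupport_boxCutoff_subset hδ)
  refine ⟨(contDiff_boxCutoff a b δ).mul hφ, ?_, h1.trans fun x hx j _ => ?_⟩
  · exact isCompact_Icc.of_isClosed_subset (isClosed_tsupport _) h1
  · exact ⟨by linarith [hx.1 j], by linarith [hx.2 j]⟩

theorem partialD_boxCutoff (a b : Fin n → ℝ) (δ : ℝ) (i : Fin n) (x : Fin n → ℝ) :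
    partialD i (boxCutoff a b δ) x = deriv (intervalCutoff (a i) (b i) δ) (x i)
      * ∏ j ∈ Finset.univ.erase i, intervalCutoff (a j) (b j) δ (x j) := by
  have h1 := hasDerivAt_comp_update
    ((contDiff_boxCutoff a b δ).differentiable (by simp)) i x (x i)
  rw [Function.update_eq_self] at h1
  have h2 : (fun w => boxCutoff a b δ (Function.update x i w))
      = fun w => intervalCutoff (a i) (b i) δ w
        * ∏ j ∈ Finset.univ.erase i, intervalCutoff (a j) (b j) δ (x j) := by
    ext w
    rw [boxCutoff, ← Finset.mul_prod_erase _ _ (Finset.mem_univ i), Function.update_self]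
    congr 1
    refine Finset.prod_congr rfl fun j hj => ?_
    rw [Function.update_of_ne (Finset.ne_of_mem_erase hj)]
  rw [h2] at h1
  have h3 : HasDerivAt (intervalCutoff (a i) (b i) δ)
      (deriv (intervalCutoff (a i) (b i) δ) (x i)) (x i) :=
    ((contDiff_intervalCutoff (a i) (b i) δ).differentiable (by simp) (x i)).hasDerivAt
  exact h1.unique (h3.mul_const _)

theorem abs_partialD_boxCutoff_le (a b : Fin n → ℝ) (δ : ℝ) (i : Fin n) (x : Fin n → ℝ) :
    |partialD i (boxCutoff a b δ) x| ≤ |deriv (intervalCutoff (a i) (b i) δ) (x i)| := by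
  rw [partialD_boxCutoff, abs_mul]
  refine mul_le_of_le_one_right (abs_nonneg _) ?_
  rw [abs_of_nonneg (Finset.prod_nonneg fun _ _ => intervalCutoff_nonneg _ _ _ _)]
  exact Finset.prod_le_one (fun _ _ => intervalCutoff_nonneg _ _ _ _)
    fun _ _ => intervalCutoff_le_one _ _ _ _

/-- The cut-off varies in the `i`-th direction only within `2δ` of the faces. Width `3δ` leaves room
so that outside the slabs `xᵢ` lies in the open interval where `intervalCutoff` is locally constant.
-/
theorem enorm_partialD_boxCutoff_le {C : ℝ} (hC : ∀ t, |deriv Real.smoothTransition t| ≤ C)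
    (hδ : 0 < δ) (hx : x ∈ box a b) :
    ‖partialD i (boxCutoff a b δ) x‖ₑ ≤ ENNReal.ofReal (2 * C / δ) *
      ((slab i (a i) (a i + 3 * δ)).indicator (fun _ => 1) x
        + (slab i (b i - 3 * δ) (b i)).indicator (fun _ => 1) x) := by
  have hxi : x i ∈ Set.Ioo (a i) (b i) := hx i (Set.mem_univ i)
  have h1 : ‖partialD i (boxCutoff a b δ) x‖ₑ ≤ ENNReal.ofReal (2 * C / δ) := by
    rw [Real.enorm_eq_ofReal_abs]
    exact ENNReal.ofReal_le_ofReal ((abs_partialD_boxCutoff_le a b δ i x).trans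
      (abs_deriv_intervalCutoff_le hC hδ _ _ _))
  by_cases hl : x i < a i + 3 * δ
  · rw [Set.indicator_of_mem (show x ∈ slab i (a i) (a i + 3 * δ) from ⟨hxi.1, hl⟩), mul_add,
      mul_one]
    exact h1.trans le_self_add
  by_cases hr : b i - 3 * δ < x i
  · rw [Set.indicator_of_mem (show x ∈ slab i (b i - 3 * δ) (b i) from ⟨hr, hxi.2⟩), mul_add,
      mul_one]
    exact h1.trans le_add_self
  have h2 := abs_partialD_boxCutoff_le a b δ i x
  rw [deriv_intervalCutoff_eq_zero hδ ⟨by linarith, by linarith⟩, abs_zero] at h2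
  rw [abs_eq_zero.1 (le_antisymm h2 (abs_nonneg _)), enorm_zero]
  exact zero_le

theorem eventually_notMem_slab (hx : x ∈ box a b) :
    ∀ᶠ δ in 𝓝[>] (0 : ℝ), x ∉ slab i (a i) (a i + 3 * δ) ∧ x ∉ slab i (b i - 3 * δ) (b i) := by
  have hxi : x i ∈ Set.Ioo (a i) (b i) := hx i (Set.mem_univ i)
  have h1 : ∀ᶠ δ in 𝓝[>] (0 : ℝ), δ < (x i - a i) / 3 :=
    nhdsWithin_le_nhds (Iio_mem_nhds (by linarith [hxi.1]))
  have h2 : ∀ᶠ δ in 𝓝[>] (0 : ℝ), δ < (b i - x i) / 3 :=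
    nhdsWithin_le_nhds (Iio_mem_nhds (by linarith [hxi.2]))
  filter_upwards [h1, h2] with δ h1 h2
  exact ⟨fun h => by linarith [h.2], fun h => by linarith [h.1]⟩

theorem tendsto_boxCutoff (hx : x ∈ box a b) :
    Tendsto (fun δ => boxCutoff a b δ x) (𝓝[>] (0 : ℝ)) (𝓝 1) := by
  refine tendsto_const_nhds.congr' ?_
  have h1 : ∀ᶠ δ in 𝓝[>] (0 : ℝ), ∀ j : Fin n,
      x ∉ slab j (a j) (a j + 3 * δ) ∧ x ∉ slab j (b j - 3 * δ) (b j) :=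
    eventually_all.2 fun j => eventually_notMem_slab hx
  filter_upwards [h1, self_mem_nhdsWithin] with δ h hδ
  have hδ' : (0 : ℝ) < δ := hδ
  refine (Finset.prod_eq_one fun j _ => intervalCutoff_eq_one hδ' ?_).symm
  have hxj : x j ∈ Set.Ioo (a j) (b j) := hx j (Set.mem_univ j)
  have h3 : a j + 3 * δ ≤ x j := not_lt.1 fun hh => (h j).1 ⟨hxj.1, hh⟩
  have h4 : x j ≤ b j - 3 * δ := not_lt.1 fun hh => (h j).2 ⟨hh, hxj.2⟩
  constructor <;> linarith

end Cutoff

/-! ### Testing with a function of vanishing trace -/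

section Testing

variable {n : ℕ} {a b : Fin n → ℝ} {i : Fin n} {u : (Fin n → ℝ) → ℝ}
  {D F : Fin n → (Fin n → ℝ) → ℝ} {φ : ℕ → (Fin n → ℝ) → ℝ}

theorem partialD_mul {f g : (Fin n → ℝ) → ℝ} (hf : Differentiable ℝ f)
    (hg : Differentiable ℝ g) (i : Fin n) (x : Fin n → ℝ) :
    partialD i (fun x => f x * g x) x = f x * partialD i g x + g x * partialD i f x := by
  have := ((hf x).hasFDerivAt.mul (hg x).hasFDerivAt).fderiv
  rw [partialD, show (fun x => f x * g x) = f * g from rfl, this]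
  simp [partialD]

theorem exists_bound_of_continuous {f : (Fin n → ℝ) → ℝ} (hf : Continuous f)
    (a b : Fin n → ℝ) : ∃ C, ∀ x ∈ box a b, ‖f x‖ ≤ C := by
  obtain ⟨C, hC⟩ := (isCompact_Icc (a := a) (b := b)).exists_bound_of_continuousOn
    hf.continuousOn
  exact ⟨C, fun x hx => hC x ⟨fun j => (hx j (Set.mem_univ j)).1.le,
    fun j => (hx j (Set.mem_univ j)).2.le⟩⟩

theorem memLp_mul_continuous {f g : (Fin n → ℝ) → ℝ} (hf : MemLp f 2 (boxMeasure a b))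
    (hg : Continuous g) : MemLp (fun x => f x * g x) 2 (boxMeasure a b) := by
  obtain ⟨C, hC⟩ := exists_bound_of_continuous hg a b
  refine hf.of_le_mul (c := C) (hf.1.mul hg.aestronglyMeasurable) ?_
  filter_upwards [ae_mem_box a b] with x hx
  rw [norm_mul, mul_comm]
  exact mul_le_mul_of_nonneg_right (hC x hx) (norm_nonneg _)

theorem memLp_of_continuous {g : (Fin n → ℝ) → ℝ} (hg : Continuous g) :
    MemLp g 2 (boxMeasure a b) := by
  simpa using memLp_mul_continuous (memLp_const (1 : ℝ)) hg

/-- Test with `boxCutoff a b δ * φ k`, apply the product rule and let `k → ∞` with `δ` fixed. For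
fixed `δ` the cut-off and its gradient are bounded, so `L²` convergence is enough. -/
theorem IsZeroTraceApprox.sum_cutoff_eq_zero (h : IsZeroTraceApprox a b u D φ)
    (hF : ∀ i, MemLp (F i) 2 (boxMeasure a b))
    (hdiv : ∀ ψ, IsTestFunction (box a b) ψ →
      ∑ i, ∫ x, F i x * partialD i ψ x ∂boxMeasure a b = 0) {δ : ℝ} (hδ : 0 < δ) :
    ∑ i, (∫ x, F i x * boxCutoff a b δ x * D i x ∂boxMeasure a b
      + ∫ x, F i x * partialD i (boxCutoff a b δ) x * u x ∂boxMeasure a b) = 0 := by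
  have hχ : ContDiff ℝ 1 (boxCutoff a b δ) :=
    (contDiff_boxCutoff a b δ).of_le (by exact_mod_cast le_top)
  have hφ : ∀ k, ContDiff ℝ 1 (φ k) := fun k =>
    (h.smooth k).of_le (by exact_mod_cast le_top)
  have hm1 : ∀ i, MemLp (fun x => F i x * boxCutoff a b δ x) 2 (boxMeasure a b) := fun i =>
    memLp_mul_continuous (hF i) hχ.continuous
  have hm2 : ∀ i, MemLp (fun x => F i x * partialD i (boxCutoff a b δ) x) 2
      (boxMeasure a b) := fun i =>
    memLp_mul_continuous (hF i) (continuous_partialD hχ i)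
  have hm3 : ∀ k, MemLp (φ k) 2 (boxMeasure a b) := fun k =>
    memLp_of_continuous (hφ k).continuous
  have hm4 : ∀ i k, MemLp (partialD i (φ k)) 2 (boxMeasure a b) := fun i k =>
    memLp_of_continuous (continuous_partialD (hφ k) i)
  have hlim : Tendsto (fun k => ∑ i,
      (∫ x, F i x * boxCutoff a b δ x * partialD i (φ k) x ∂boxMeasure a b
        + ∫ x, F i x * partialD i (boxCutoff a b δ) x * φ k x ∂boxMeasure a b)) atTop
      (𝓝 (∑ i, (∫ x, F i x * boxCutoff a b δ x * D i x ∂boxMeasure a b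
        + ∫ x, F i x * partialD i (boxCutoff a b δ) x * u x ∂boxMeasure a b))) :=
    tendsto_finsetSum _ fun i _ =>
      (tendsto_integral_mul_of_eLpNorm_two (hm1 i) (hm4 i) (h.memLp_grad i)
        (h.tendsto_grad i)).add
      (tendsto_integral_mul_of_eLpNorm_two (hm2 i) hm3 h.memLp h.tendsto)
  refine tendsto_nhds_unique hlim (tendsto_const_nhds.congr fun k => ?_)
  rw [← hdiv _ (isTestFunction_boxCutoff_mul hδ (h.smooth k))]
  refine Finset.sum_congr rfl fun i _ => ?_
  have i1 : Integrable (fun x => F i x * boxCutoff a b δ x * partialD i (φ k) x)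
    (boxMeasure a b) := (hm1 i).integrable_mul (hm4 i k)
  have i2 : Integrable (fun x => F i x * partialD i (boxCutoff a b δ) x * φ k x)
    (boxMeasure a b) := (hm2 i).integrable_mul (hm3 k)
  rw [← integral_add i1 i2]
  refine integral_congr_ae (Eventually.of_forall fun x => ?_)
  simp only [partialD_mul (hχ.differentiable one_ne_zero) ((hφ k).differentiable one_ne_zero)]
  ring

/-- Zero trace makes `u` of size `δ` in `L²` on the strips, which cancels the factor `1/δ` from the
gradient of the cut-off. What remains is the `L²` norm of `G` on the strips, and this tends to zero.
-/
theorem IsZeroTraceApprox.tendsto_cutoff_grad (h : IsZeroTraceApprox a b u D φ)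
    (hab : a i < b i) {G : (Fin n → ℝ) → ℝ} (hG : MemLp G 2 (boxMeasure a b)) :
    Tendsto (fun δ => ∫ x, G x * partialD i (boxCutoff a b δ) x * u x ∂boxMeasure a b)
      (𝓝[>] (0 : ℝ)) (𝓝 0) := by
  obtain ⟨C, hC0, hC⟩ := exists_bound_deriv_smoothTransition
  set μ := boxMeasure a b
  have tl : Tendsto (fun δ => eLpNorm G 2 (μ.restrict (slab i (a i) (a i + 3 * δ))))
      (𝓝[>] (0 : ℝ)) (𝓝 0) := by
    refine tendsto_eLpNorm_two_restrict_zero hG (fun _ => measurableSet_slab _ _ _) ?_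
    filter_upwards [ae_mem_box a b] with x hx
    exact (eventually_notMem_slab hx).mono fun _ hδ => hδ.1
  have tr : Tendsto (fun δ => eLpNorm G 2 (μ.restrict (slab i (b i - 3 * δ) (b i))))
      (𝓝[>] (0 : ℝ)) (𝓝 0) := by
    refine tendsto_eLpNorm_two_restrict_zero hG (fun _ => measurableSet_slab _ _ _) ?_
    filter_upwards [ae_mem_box a b] with x hx
    exact (eventually_notMem_slab hx).mono fun _ hδ => hδ.2
  have tb : Tendsto (fun δ => ENNReal.ofReal (12 * C) * eLpNorm (D i) 2 μ *
      (eLpNorm G 2 (μ.restrict (slab i (a i) (a i + 3 * δ)))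
        + eLpNorm G 2 (μ.restrict (slab i (b i - 3 * δ) (b i))))) (𝓝[>] (0 : ℝ)) (𝓝 0) := by
    simpa only [add_zero, mul_zero] using ENNReal.Tendsto.const_mul (tl.add tr)
      (Or.inr (ENNReal.mul_ne_top ENNReal.ofReal_ne_top (h.memLp_grad i).2.ne))
  have hsmall : ∀ᶠ δ in 𝓝[>] (0 : ℝ), δ < (b i - a i) / 3 :=
    nhdsWithin_le_nhds (Iio_mem_nhds (by linarith))
  have key : ∀ᶠ δ in 𝓝[>] (0 : ℝ),
      ‖∫ x, G x * partialD i (boxCutoff a b δ) x * u x ∂μ‖ₑ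
        ≤ ENNReal.ofReal (12 * C) * eLpNorm (D i) 2 μ *
      (eLpNorm G 2 (μ.restrict (slab i (a i) (a i + 3 * δ)))
        + eLpNorm G 2 (μ.restrict (slab i (b i - 3 * δ) (b i)))) := by
    filter_upwards [hsmall, self_mem_nhdsWithin] with δ hδs hδ
    have hδ' : (0 : ℝ) < δ := hδ
    set Tl := slab i (a i) (a i + 3 * δ)
    set Tr := slab i (b i - 3 * δ) (b i)
    have hTl : MeasurableSet Tl := measurableSet_slab _ _ _
    have hTr : MeasurableSet Tr := measurableSet_slab _ _ _
    have hul : eLpNorm u 2 (μ.restrict Tl) ≤ ENNReal.ofReal (6 * δ) * eLpNorm (D i) 2 μ := by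
      refine (h.slab_le hab le_rfl (by linarith)
        (Set.left_mem_Icc.2 (by linarith)) (Or.inl rfl)).trans ?_
      exact mul_le_mul' (ENNReal.ofReal_le_ofReal (by linarith))
        (eLpNorm_mono_measure _ Measure.restrict_le_self)
    have hur : eLpNorm u 2 (μ.restrict Tr) ≤ ENNReal.ofReal (6 * δ) * eLpNorm (D i) 2 μ := by
      refine (h.slab_le hab (by linarith) le_rfl
        (Set.right_mem_Icc.2 (by linarith)) (Or.inr rfl)).trans ?_
      exact mul_le_mul' (ENNReal.ofReal_le_ofReal (by linarith))
        (eLpNorm_mono_measure _ Measure.restrict_le_self)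
    have hmGu : AEMeasurable (fun x => ‖G x‖ₑ * ‖u x‖ₑ) μ := hG.1.enorm.mul h.memLp.1.enorm
    calc ‖∫ x, G x * partialD i (boxCutoff a b δ) x * u x ∂μ‖ₑ
        ≤ ∫⁻ x, ‖G x * partialD i (boxCutoff a b δ) x * u x‖ₑ ∂μ :=
          enorm_integral_le_lintegral_enorm _
      _ ≤ ∫⁻ x, ENNReal.ofReal (2 * C / δ) * (Tl.indicator (fun x => ‖G x‖ₑ * ‖u x‖ₑ) x
            + Tr.indicator (fun x => ‖G x‖ₑ * ‖u x‖ₑ) x) ∂μ := by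
          refine lintegral_mono_ae ?_
          filter_upwards [ae_mem_box a b] with x hx
          rw [enorm_mul, enorm_mul, mul_right_comm]
          refine (mul_le_mul_right (enorm_partialD_boxCutoff_le hC hδ' hx) _).trans ?_
          have hind : ∀ T : Set (Fin n → ℝ), ‖G x‖ₑ * ‖u x‖ₑ * T.indicator (fun _ => 1) x
              = T.indicator (fun x => ‖G x‖ₑ * ‖u x‖ₑ) x := by
            intro T
            by_cases hxT : x ∈ T <;> simp [hxT]
          rw [mul_left_comm, mul_add, hind, hind]
      _ = ENNReal.ofReal (2 * C / δ) * (∫⁻ x in Tl, ‖G x‖ₑ * ‖u x‖ₑ ∂μ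
            + ∫⁻ x in Tr, ‖G x‖ₑ * ‖u x‖ₑ ∂μ) := by
          rw [lintegral_const_mul' _ _ ENNReal.ofReal_ne_top,
            lintegral_add_left' (hmGu.indicator hTl), lintegral_indicator hTl,
            lintegral_indicator hTr]
      _ ≤ ENNReal.ofReal (2 * C / δ) *
            (eLpNorm G 2 (μ.restrict Tl) * (ENNReal.ofReal (6 * δ) * eLpNorm (D i) 2 μ)
            + eLpNorm G 2 (μ.restrict Tr) * (ENNReal.ofReal (6 * δ) * eLpNorm (D i) 2 μ)) := by
          gcongr
          · exact (lintegral_enorm_mul_le hG.1.restrict h.memLp.1.restrict).trans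
              (mul_le_mul_right hul _)
          · exact (lintegral_enorm_mul_le hG.1.restrict h.memLp.1.restrict).trans
              (mul_le_mul_right hur _)
      _ = _ := by
          -- Here `δ` cancels: the gradient bound `2C/δ` meets the strip bound with constant `2 ·
          -- 3δ`.
          have hconst : ENNReal.ofReal (12 * C)
              = ENNReal.ofReal (2 * C / δ) * ENNReal.ofReal (6 * δ) := by
            rw [← ENNReal.ofReal_mul (by positivity)]
            congr 1
            field_simp
            ring
          rw [hconst]
          ring
  have hfin := tendsto_of_tendsto_of_tendsto_of_le_of_le' tendsto_const_nhds tb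
    (Eventually.of_forall fun _ => zero_le) key
  rw [tendsto_zero_iff_norm_tendsto_zero]
  exact ((ENNReal.tendsto_toReal ENNReal.zero_ne_top).comp hfin).congr fun δ => toReal_enorm _

theorem tendsto_integral_boxCutoff_mul {f g : (Fin n → ℝ) → ℝ}
    (hf : MemLp f 2 (boxMeasure a b)) (hg : MemLp g 2 (boxMeasure a b)) :
    Tendsto (fun δ => ∫ x, f x * boxCutoff a b δ x * g x ∂boxMeasure a b)
      (𝓝[>] (0 : ℝ)) (𝓝 (∫ x, f x * g x ∂boxMeasure a b)) := by
  refine tendsto_integral_filter_of_dominated_convergence (fun x => ‖f x * g x‖)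
    (Eventually.of_forall fun δ => ?_) (Eventually.of_forall fun δ => ?_)
    (hf.integrable_mul hg).norm ?_
  · exact (hf.1.mul (contDiff_boxCutoff a b δ).continuous.aestronglyMeasurable).mul hg.1
  · refine Eventually.of_forall fun x => ?_
    rw [mul_right_comm, norm_mul, Real.norm_of_nonneg (boxCutoff_nonneg a b δ x)]
    exact mul_le_of_le_one_right (norm_nonneg _) (boxCutoff_le_one a b δ x)
  · filter_upwards [ae_mem_box a b] with x hx
    simpa using ((tendsto_boxCutoff hx).const_mul (f x)).mul_const (g x)

/-- A square integrable field that is divergence free in the sense of distributions is orthogonal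
to the gradient of a function with vanishing trace. -/
theorem IsZeroTraceApprox.sum_integral_mul_eq_zero (h : IsZeroTraceApprox a b u D φ)
    (hab : ∀ i, a i < b i) (hF : ∀ i, MemLp (F i) 2 (boxMeasure a b))
    (hdiv : ∀ ψ, IsTestFunction (box a b) ψ →
      ∑ i, ∫ x, F i x * partialD i ψ x ∂boxMeasure a b = 0) :
    ∑ i, ∫ x, F i x * D i x ∂boxMeasure a b = 0 := by
  have hlim := tendsto_finsetSum Finset.univ fun i _ =>
    (tendsto_integral_boxCutoff_mul (hF i) (h.memLp_grad i)).add
      (h.tendsto_cutoff_grad (hab i) (hF i))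
  simp only [add_zero] at hlim
  refine tendsto_nhds_unique hlim (tendsto_const_nhds.congr' ?_)
  filter_upwards [self_mem_nhdsWithin] with δ hδ
  exact (h.sum_cutoff_eq_zero hF hdiv hδ).symm

end Testing

/-! ### Differences of solutions -/

section Solutions

variable {n : ℕ} {a b : Fin n → ℝ} {α : ℝ} {p q : Fin n → ℝ} {f g u u₁ u₂ : (Fin n → ℝ) → ℝ}

theorem leftInt_zero (a : Fin n → ℝ) (i : Fin n) (v : (Fin n → ℝ) → ℝ) :
    leftInt a 0 i v = v := by
  ext x
  simp [leftInt]

theorem MemHhat.memLp_weakPartial (h : MemHhat a b 1 u) (i : Fin n) :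
    MemLp (weakPartial (box a b) i u) 2 (boxMeasure a b) := by
  simpa [rlDeriv, leftInt_zero] using h.memLp_deriv i

/-- Subtract the two approximating sequences; the common `g` cancels on the boundary. The gradient
is the difference of the chosen weak derivatives, so linearity of `weakPartial` is not required. -/
theorem HasTrace.exists_isZeroTraceApprox (h₁ : HasTrace a b u₁ g) (h₂ : HasTrace a b u₂ g)
    (hu₁ : MemHhat a b 1 u₁) (hu₂ : MemHhat a b 1 u₂) :
    ∃ φ, IsZeroTraceApprox a b (u₁ - u₂)
      (fun i => weakPartial (box a b) i u₁ - weakPartial (box a b) i u₂) φ := by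
  obtain ⟨hg, φ₁, hφ₁, hu1, hd1, hb1⟩ := h₁
  obtain ⟨-, φ₂, hφ₂, hu2, hd2, hb2⟩ := h₂
  have key : ∀ {ν : Measure (Fin n → ℝ)} {A B : ℕ → (Fin n → ℝ) → ℝ} {c d : (Fin n → ℝ) → ℝ},
      (∀ k, AEStronglyMeasurable (A k) ν) → (∀ k, AEStronglyMeasurable (B k) ν) →
      AEStronglyMeasurable c ν → AEStronglyMeasurable d ν →
      Tendsto (fun k => eLpNorm (fun x => A k x - c x) 2 ν) atTop (𝓝 0) →
      Tendsto (fun k => eLpNorm (fun x => B k x - d x) 2 ν) atTop (𝓝 0) →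
      Tendsto (fun k => eLpNorm (fun x => (A k x - B k x) - (c x - d x)) 2 ν) atTop (𝓝 0) := by
    intro ν A B c d hA hB hc hd h1 h2
    have h3 := h1.add h2
    rw [add_zero] at h3
    refine tendsto_of_tendsto_of_tendsto_of_le_of_le tendsto_const_nhds h3
      (fun _ => zero_le) (fun k => ?_)
    have h4 := eLpNorm_sub_le ((hA k).sub hc) ((hB k).sub hd) (p := 2) one_le_two
    have h5 : (fun x => (A k x - B k x) - (c x - d x)) = (A k - c) - (B k - d) := by
      ext x
      simp only [Pi.sub_apply]
      ring
    rw [h5]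
    exact h4
  have hφ₁' : ∀ k, ContDiff ℝ 1 (φ₁ k) := fun k => (hφ₁ k).of_le (by exact_mod_cast le_top)
  have hφ₂' : ∀ k, ContDiff ℝ 1 (φ₂ k) := fun k => (hφ₂ k).of_le (by exact_mod_cast le_top)
  refine ⟨fun k x => φ₁ k x - φ₂ k x, fun k => (hφ₁ k).sub (hφ₂ k), hu₁.memLp.sub hu₂.memLp,
    fun i => (hu₁.memLp_weakPartial i).sub (hu₂.memLp_weakPartial i), ?_, fun i => ?_, ?_⟩
  · exact key (fun k => (hφ₁ k).continuous.aestronglyMeasurable)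
      (fun k => (hφ₂ k).continuous.aestronglyMeasurable) hu₁.memLp.1 hu₂.memLp.1 hu1 hu2
  · have hsub : ∀ k x, partialD i (fun x => φ₁ k x - φ₂ k x) x
        = partialD i (φ₁ k) x - partialD i (φ₂ k) x := by
      intro k x
      simp only [partialD]
      rw [fderiv_fun_sub ((hφ₁' k).differentiable one_ne_zero x)
        ((hφ₂' k).differentiable one_ne_zero x)]
      rfl
    simp only [hsub, Pi.sub_apply]
    exact key (fun k => (continuous_partialD (hφ₁' k) i).aestronglyMeasurable)
      (fun k => (continuous_partialD (hφ₂' k) i).aestronglyMeasurable)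
      (hu₁.memLp_weakPartial i).1 (hu₂.memLp_weakPartial i).1 (hd1 i) (hd2 i)
  · have := key (fun k => (hφ₁ k).continuous.aestronglyMeasurable)
      (fun k => (hφ₂ k).continuous.aestronglyMeasurable) hg.1 hg.1 hb1 hb2
    simpa only [sub_self, sub_zero] using this

theorem memLp_flux (hα : 0 < α) (hab : ∀ i, a i < b i) (hu : MemHhat a b 1 u) (i : Fin n) :
    MemLp (flux a b α p q i u) 2 (boxMeasure a b) :=
  ((memLp_leftInt hα (hab i) (hu.memLp_weakPartial i)).const_mul (p i)).add
    ((memLp_rightInt hα (hab i) (hu.memLp_weakPartial i)).const_mul (q i))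

theorem IsTestFunction.memLp_partialD {ψ : (Fin n → ℝ) → ℝ} (hψ : IsTestFunction (box a b) ψ)
    (i : Fin n) : MemLp (partialD i ψ) 2 (boxMeasure a b) :=
  memLp_of_continuous
    (continuous_partialD (hψ.smooth.of_le (by exact_mod_cast le_top)) i)

theorem IsSolution.sum_integral_flux_sub (hα : 0 < α) (hab : ∀ i, a i < b i)
    (h₁ : IsSolution a b α p q f g u₁) (h₂ : IsSolution a b α p q f g u₂)
    (ψ : (Fin n → ℝ) → ℝ) (hψ : IsTestFunction (box a b) ψ) :
    ∑ i, ∫ x, (flux a b α p q i u₁ - flux a b α p q i u₂) x * partialD i ψ x ∂boxMeasure a b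
      = 0 := by
  have h := (h₁.equation ψ hψ).trans (h₂.equation ψ hψ).symm
  rw [← sub_eq_zero, ← Finset.sum_sub_distrib] at h
  rw [← h]
  refine Finset.sum_congr rfl fun i _ => ?_
  have i1 : Integrable (fun x => flux a b α p q i u₁ x * partialD i ψ x) (boxMeasure a b) :=
    (memLp_flux hα hab h₁.memHhat i).integrable_mul (hψ.memLp_partialD i)
  have i2 : Integrable (fun x => flux a b α p q i u₂ x * partialD i ψ x) (boxMeasure a b) :=
    (memLp_flux hα hab h₂.memHhat i).integrable_mul (hψ.memLp_partialD i)
  simp only [Pi.sub_apply, sub_mul]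
  exact integral_sub i1 i2

theorem flux_sub_ae (hα : 0 < α) (hab : ∀ i, a i < b i) (hu₁ : MemHhat a b 1 u₁)
    (hu₂ : MemHhat a b 1 u₂) (i : Fin n) :
    flux a b α p q i u₁ - flux a b α p q i u₂ =ᵐ[boxMeasure a b] fun x =>
      p i * leftInt a α i (weakPartial (box a b) i u₁ - weakPartial (box a b) i u₂) x
      + q i * rightInt b α i (weakPartial (box a b) i u₁ - weakPartial (box a b) i u₂) x := by
  filter_upwards [leftInt_sub_ae hα (hab i) (hu₁.memLp_weakPartial i) (hu₂.memLp_weakPartial i),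
    rightInt_sub_ae hα (hab i) (hu₁.memLp_weakPartial i) (hu₂.memLp_weakPartial i)] with x hl hr
  rw [hl, hr]
  simp only [Pi.sub_apply, flux]
  ring

/-- Two solutions of the Dirichlet problem agree almost everywhere. -/
theorem IsSolution.sub_ae_eq_zero (hα0 : 0 < α) (hα1 : α < 1) (hab : ∀ i, a i < b i)
    (hp : ∀ i, 0 < p i) (hq : ∀ i, 0 < q i) (i : Fin n)
    (h₁ : IsSolution a b α p q f g u₁) (h₂ : IsSolution a b α p q f g u₂) :
    u₁ - u₂ =ᵐ[boxMeasure a b] 0 := by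
  obtain ⟨φ, hφ⟩ :=
    h₁.boundary.exists_isZeroTraceApprox h₂.boundary h₁.memHhat h₂.memHhat
  have horth := hφ.sum_integral_mul_eq_zero hab
    (fun i => (memLp_flux (p := p) (q := q) hα0 hab h₁.memHhat i).sub
      (memLp_flux hα0 hab h₂.memHhat i))
    (h₁.sum_integral_flux_sub hα0 hab h₂)
  refine hφ.ae_eq_zero (hab i)
    (ae_eq_zero_of_sum_energy hα0 hα1 hab hp hq hφ.memLp_grad ?_ i)
  rw [← horth]
  refine Finset.sum_congr rfl fun j _ => integral_congr_ae ?_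
  filter_upwards [flux_sub_ae (p := p) (q := q) hα0 hab h₁.memHhat h₂.memHhat j] with x hx
  rw [hx]

theorem IsWeakPartial.of_ae_eq_zero {i : Fin n} {v : (Fin n → ℝ) → ℝ}
    (hv : v =ᵐ[boxMeasure a b] 0) : IsWeakPartial (box a b) i v 0 where
  locallyIntegrable :=
    (IntegrableOn.congr_fun_ae integrableOn_zero hv.symm).locallyIntegrableOn
  locallyIntegrable_deriv := integrableOn_zero.locallyIntegrableOn
  integral_eq φ _ := by
    have : ∫ x in box a b, v x * partialD i φ x = ∫ x in box a b, (0 : ℝ) :=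
      integral_congr_ae (hv.mono fun x hx => by simp [hx])
    simp [this]

/-- The fundamental lemma of the calculus of variations. It is needed because `weakPartial` is an
arbitrary choice, so the zero derivative has to be identified almost everywhere. -/
theorem IsWeakPartial.ae_eq_zero {i : Fin n} {v D : (Fin n → ℝ) → ℝ}
    (h : IsWeakPartial (box a b) i v D) (hv : v =ᵐ[boxMeasure a b] 0) :
    D =ᵐ[boxMeasure a b] 0 := by
  refine (ae_restrict_iff' (measurableSet_box a b)).2 ?_
  refine (isOpen_box a b).ae_eq_zero_of_integral_contDiff_smul_eq_zero
    h.locallyIntegrable_deriv fun φ hφ hc hs => ?_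
  have h1 := h.integral_eq φ ⟨hφ, hc, hs⟩
  have h2 : ∫ x in box a b, v x * partialD i φ x = ∫ x in box a b, (0 : ℝ) :=
    integral_congr_ae (hv.mono fun x hx => by simp [hx])
  rw [h2, integral_zero, zero_eq_neg] at h1
  rw [← h1, ← setIntegral_eq_integral_of_forall_compl_eq_zero (s := box a b)]
  · simp only [smul_eq_mul, mul_comm]
  · intro x hx
    rw [image_eq_zero_of_notMem_tsupport fun h => hx (hs h), zero_smul]

theorem memHhat_of_ae_eq_zero {v : (Fin n → ℝ) → ℝ} (hα : α ≠ 0)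
    (hv : v =ᵐ[boxMeasure a b] 0) :
    MemHhat a b (1 - α) v ∧ hhatNorm a b (1 - α) v = 0 := by
  have hI : ∀ i, leftInt a (1 - (1 - α)) i v =ᵐ[boxMeasure a b] 0 := fun i => by
    rw [sub_sub_cancel]
    exact leftInt_ae_eq_zero hα hv
  have hex : ∀ i, ∃ D, IsWeakPartial (box a b) i (leftInt a (1 - (1 - α)) i v) D :=
    fun i => ⟨0, .of_ae_eq_zero (hI i)⟩
  have hD : ∀ i, rlDeriv a b (1 - α) i v =ᵐ[boxMeasure a b] 0 := fun i => by
    rw [rlDeriv, weakPartial, dif_pos (hex i)]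
    exact (hex i).choose_spec.ae_eq_zero (hI i)
  refine ⟨⟨(memLp_congr_ae hv).2 .zero, hex, fun i => (memLp_congr_ae (hD i)).2 .zero⟩, ?_⟩
  rw [hhatNorm, Finset.sum_eq_zero, Real.sqrt_zero]
  intro i _
  refine integral_eq_zero_of_ae ?_
  filter_upwards [hD i] with x hx
  simp [hx]

end Solutions

end FADE

theorem mainTheorem1 {n : ℕ} (a b : Fin n → ℝ) (hab : ∀ i, a i < b i)
    (α : ℝ) (hα : α ∈ Set.Ioo (0 : ℝ) 1)
    (p q : Fin n → ℝ) (hp : ∀ i, 0 < p i) (hq : ∀ i, 0 < q i) (hpq : ∑ i, (p i + q i) = 1)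
    (f g : (Fin n → ℝ) → ℝ) (hf : LocallyIntegrableOn f (FADE.box a b))
    (u₁ u₂ : (Fin n → ℝ) → ℝ)
    (h₁ : FADE.IsSolution a b α p q f g u₁) (h₂ : FADE.IsSolution a b α p q f g u₂) :
    FADE.MemHhat a b (1 - α) (u₁ - u₂) ∧ FADE.hhatNorm a b (1 - α) (u₁ - u₂) = 0 := by
  -- In dimension zero the sum in `hpq` is empty and cannot equal `1`; a direction is needed for
  -- Poincaré's inequality.
  have hn : Nonempty (Fin n) := by
    by_contra h
    rw [not_nonempty_iff] at h
    simp at hpq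
  exact FADE.memHhat_of_ae_eq_zero hα.1.ne'
    (h₁.sub_ae_eq_zero hα.1 hα.2 hab hp hq hn.some h₂)
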